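/- Let $\alpha>\tfrac12$ and $L>0$. There is $\varrho_0>0$, depending only on $\alpha$ and $L$, such that the following holds for every $\varrho\ge\varrho_0$. Put $a(t,s)=\frac1{\Gamma(\alpha)}(t-s)^{\alpha-1}e^{-\varrho(t-s)}$. **Setting.** Let $(\Omega,\mathcal F,\{\mathcal F_t\}_{t\ge0},\mathbb P)$ be a filtered probability space and let $B^{H,\lambda}$ be an adapted $\mathbb R^d$-valued tempered fractional Brownian motion with $H>\tfrac12$ and $\lambda>0$. That is, $B^{H,\lambda}$ is a centred Gaussian process with independent components, each with covariance $\int_{\mathbb R}k_s(x)k_t(x)\,dx$, where $k_t(x)=e^{-\lambda(t-x)_+}(t-x)_+^{H-1/2}-e^{-\lambda(-x)_+}(-x)_+^{H-1/2}$. Assume: 1. $(P,d_P)$ is a compact metric space with a base point $0\in P$, and $\{\vartheta_t\}_{t\in\mathbb R}$ is a group of continuous maps $P\to P$ with measurable orbits $t\mapsto\vartheta_t(p)$. Write $\|p\|_P=d_P(p,0)$. 2. There is $M>0$ with $\int_0^t a(t,s)\|\vartheta_s(p)\|_P^2\,ds<M$ for all $t>0$ and $p\in P$. 3. $g:\mathbb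 R^d\times P\to\mathbb R^d$ satisfies $\mathbb E\|g(x,p)-g(y,q)\|^2\le L\,\mathbb E\|x-y\|^2+L\,d_P(p,q)^2$ for all $x,y\in L^2(\Omega;\mathbb R^d)$ and $p,q\in P$. A solution $x(\cdot,x_0,p)$ with $p\in P$ and initial value $x_0\in L^2(\Omega,\mathcal F_0;\mathbb R^d)$ is an adapted mean-square continuous process on $[0,\infty)$ such that, in $L^2(\Omega;\mathbb R^d)$ and for all $t\ge0$, $$x(t)=x_0e^{-\varrho t}+\int_0^t a(t,s)\,g(x(s),\vartheta_s(p))\,ds+\int_0^t a(t,s)\,dB^{H,\lambda}(s),$$ where the last integral is a Wiener integral. This is the integral form of the Caputo fractional substantial equation $D^\alpha_{0+}x(t)=g(x(t),\vartheta_t(p))+\frac{dB^{H,\lambda}(t)}{dt}$. Bounded sets $D$ of initial values are bounded subsets of $L^2(\Omega,\mathcal F_0;\mathbb R^d)$. $L^2_w(\Omega;\mathbb R^d)$ denotes $L^2(\Omega,\mathcal F;\mathbb R^d)$ with its weak topology. A set $A$ *attracts $D$ in the weak topology* if for every weak neighbourhood $V$ of $0$ there is $T\ge 0$ such that $x(t,x_0,p)\in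 A+V$ for all $t\ge T$, $x_0\in D$, $p\in P$ and all solutions. **Conclusion.** (i) For every bounded $D$, all $t_n\to+\infty$, $\{x_{0,n}\}\subset D$, $\{p_n\}\subset P$, and every sequence of solutions, the sequence $\{x(t_n,x_{0,n},p_n)\}$ is relatively compact in $L^2_w(\Omega;\mathbb R^d)$: its range has weakly compact closure and it has a weakly convergent subsequence. (ii) For every bounded $D$, the set $$\omega_p(D)=\{y:\ \exists\,t_n\to+\infty,\ \{x_{0,n}\}\subset D,\ \{p_n\}\subset P\text{ and solutions with }x(t_n,x_{0,n},p_n)\to y\text{ in }L^2_w(\Omega;\mathbb R^d)\}$$ is nonempty (if $D\neq\emptyset$), weakly compact, and attracts $D$ in the weak topology. (iii) The set $\Omega_p^*=\overline{\bigcup\{\omega_p(D): D\text{ bounded}\}}^{\,w}$ is bounded in $L^2(\Omega;\mathbb R^d)$, weakly compact, and is the minimal weakly closed set attracting all bounded sets $D$ in the weak topology: it is weakly closed, attracts every bounded $D$, and is contained in every weakly closed set that does. -/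

import Mathlib

open MeasureTheory ProbabilityTheory Filter Topology Set
open scoped NNReal ENNReal

noncomputable section

/-- The space `L²(Ω; ℝᵈ)` of (classes of) square integrable random vectors. -/
abbrev L2 {Ω : Type*} [MeasurableSpace Ω] (d : ℕ) (μ : Measure Ω) : Type _ :=
  Lp (EuclideanSpace ℝ (Fin d)) 2 μ

/-- The space `L²_w(Ω; ℝᵈ)`: `L²(Ω; ℝᵈ)` with its weak topology. -/
abbrev L2w {Ω : Type*} [MeasurableSpace Ω] (d : ℕ) (μ : Measure Ω) : Type _ :=
  WeakSpace ℝ (L2 d μ)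

/-- The identity map from `L²(Ω; ℝᵈ)` to `L²_w(Ω; ℝᵈ)`. -/
def toL2w {Ω : Type*} [MeasurableSpace Ω] {d : ℕ} {μ : Measure Ω} (x : L2 d μ) : L2w d μ :=
  toWeakSpace ℝ (L2 d μ) x

/-- The memory kernel `a(t,s) = (t-s)^{α-1} e^{-ϱ(t-s)} / Γ(α)`, for `s < t`. -/
def memoryKernel (α ϱ t s : ℝ) : ℝ :=
  1 / Real.Gamma α * (t - s) ^ (α - 1) * Real.exp (-ϱ * (t - s))

/-- The moving average kernel of tempered fractional Brownian motion,
`e^{-λ(t-x)₊} (t-x)₊^{H-1/2} - e^{-λ(-x)₊} (-x)₊^{H-1/2}`. -/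
def tfbmKernel (H lam t x : ℝ) : ℝ :=
  Real.exp (-lam * max (t - x) 0) * max (t - x) 0 ^ (H - 1 / 2) -
    Real.exp (-lam * max (-x) 0) * max (-x) 0 ^ (H - 1 / 2)

/-- `B` is a `d`-dimensional tempered fractional Brownian motion on `[0,∞)` with Hurst index `H`
and tempering parameter `lam`: a centred Gaussian process with independent components, each with
the covariance of the moving average `∫ tfbmKernel H lam t x dW(x)` over a two-sided Brownian
motion `W`. -/
structure IsTFBM {Ω : Type*} [MeasurableSpace Ω] {d : ℕ} (μ : Measure Ω) (H lam : ℝ)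
    (B : ℝ≥0 → Ω → EuclideanSpace ℝ (Fin d)) : Prop where
  gaussian : IsGaussianProcess (fun (ti : ℝ≥0 × Fin d) (ω : Ω) => B ti.1 ω ti.2) μ
  centred : ∀ (t : ℝ≥0) (i : Fin d), ∫ ω, B t ω i ∂μ = 0
  covariance : ∀ (s t : ℝ≥0) (i j : Fin d),
    ∫ ω, B s ω i * B t ω j ∂μ =
      if i = j then ∫ x : ℝ, tfbmKernel H lam s x * tfbmKernel H lam t x else 0

/-- The step function `∑_{i<n} cᵢ 1_{(uᵢ, uᵢ₊₁]}`. -/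
def stepFunction (n : ℕ) (u : ℕ → ℝ≥0) (c : ℕ → ℝ) (s : ℝ) : ℝ :=
  ∑ i ∈ Finset.range n, (Ioc (u i : ℝ) (u (i + 1) : ℝ)).indicator (fun _ => c i) s

/-- The integral `∑_{i<n} cᵢ (B(uᵢ₊₁) - B(uᵢ))` of a step function against the process `B`. -/
def stepIntegral {Ω : Type*} {d : ℕ} (B : ℝ≥0 → Ω → EuclideanSpace ℝ (Fin d))
    (n : ℕ) (u : ℕ → ℝ≥0) (c : ℕ → ℝ) (ω : Ω) : EuclideanSpace ℝ (Fin d) :=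
  ∑ i ∈ Finset.range n, c i • (B (u (i + 1)) ω - B (u i) ω)

/-- `Y = ∫₀ᵗ f(s) dB(s)` as a Wiener integral of the deterministic function `f ∈ L²(0,t)`: `Y` is
the mean square limit of the integrals of step functions on `(0,t]` that converge to `f` in
`L²(0,t)`. (For a tempered fractional Brownian motion with `H > 1/2` the integral of step functions
is continuous from `L²(0,t)` to `L²(Ω)`, so that `Y` exists, is unique, and does not depend on the
approximating sequence.) -/
def IsWienerIntegral {Ω : Type*} [MeasurableSpace Ω] {d : ℕ} (μ : Measure Ω)
    (B : ℝ≥0 → Ω → EuclideanSpace ℝ (Fin d)) (t : ℝ≥0) (f : ℝ → ℝ) (Y : L2 d μ) : Prop :=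
  ∃ (n : ℕ → ℕ) (u : ℕ → ℕ → ℝ≥0) (c : ℕ → ℕ → ℝ),
    (∀ k, Monotone (u k) ∧ u k (n k) ≤ t) ∧
    Tendsto (fun k => eLpNorm (fun s => stepFunction (n k) (u k) (c k) s - f s) 2
      (volume.restrict (Ioc 0 (t : ℝ)))) atTop (𝓝 0) ∧
    Tendsto (fun k => eLpNorm (fun ω => stepIntegral B (n k) (u k) (c k) ω - Y ω) 2 μ)
      atTop (𝓝 0)

open Classical in
/-- The random vector `ω ↦ g(x(ω), p)` as an element of `L²(Ω; ℝᵈ)`. It is square integrable for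
every `x ∈ L²(Ω; ℝᵈ)` when `g` is Lipschitz, so that the value `0` is then never used. -/
def superposition {Ω : Type*} [MeasurableSpace Ω] {d : ℕ} {μ : Measure Ω} {P : Type*}
    (g : EuclideanSpace ℝ (Fin d) → P → EuclideanSpace ℝ (Fin d)) (p : P) (x : L2 d μ) :
    L2 d μ :=
  if h : MemLp (fun ω => g (x ω) p) 2 μ then h.toLp _ else 0

/-- `x` is a solution on `[0,∞)`, with initial value `x₀` and parameter `p`, of the Caputo
fractional stochastic differential equation `D^α x(t) = g(x(t), ϑ_t p) + dB(t)/dt`: an adapted,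
mean square continuous process with
`x(t) = e^{-ϱt} x₀ + ∫₀ᵗ a(t,s) g(x(s), ϑ_s p) ds + ∫₀ᵗ a(t,s) dB(s)` in `L²(Ω; ℝᵈ)` for all `t`.
-/
structure IsSolution {Ω : Type*} [mΩ : MeasurableSpace Ω] {d : ℕ} (μ : Measure Ω) {P : Type*}
    (𝓕 : Filtration ℝ≥0 mΩ) (B : ℝ≥0 → Ω → EuclideanSpace ℝ (Fin d)) (α ϱ : ℝ)
    (g : EuclideanSpace ℝ (Fin d) → P → EuclideanSpace ℝ (Fin d)) (ϑ : ℝ → P → P)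
    (x₀ : L2 d μ) (p : P) (x : ℝ≥0 → L2 d μ) : Prop where
  continuous : Continuous x
  adapted : ∀ t, AEStronglyMeasurable[𝓕 t] (x t) μ
  integrable : ∀ t : ℝ≥0, IntervalIntegrable
    (fun s : ℝ => memoryKernel α ϱ t s • superposition g (ϑ s p) (x s.toNNReal)) volume 0 t
  equation : ∀ t : ℝ≥0, ∃ Y : L2 d μ,
    IsWienerIntegral μ B t (memoryKernel α ϱ t) Y ∧
    x t = Real.exp (-ϱ * t) • x₀ +
      (∫ s in (0 : ℝ)..t, memoryKernel α ϱ t s • superposition g (ϑ s p) (x s.toNNReal)) + Y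

/-- The weak `ω`-limit set `ω_p(D)` for a solution relation `S` (`S x₀ p x` says that `x` is a
solution with initial value `x₀` and parameter `p`): all weak limits of `xₙ(tₙ)`, where `tₙ → ∞`
and `xₙ` is a solution with initial value in `D` and an arbitrary parameter. -/
def weakOmegaLimit {Ω : Type*} [MeasurableSpace Ω] {d : ℕ} {μ : Measure Ω} {P : Type*}
    (S : L2 d μ → P → (ℝ≥0 → L2 d μ) → Prop) (D : Set (L2 d μ)) : Set (L2w d μ) :=
  {y | ∃ (t : ℕ → ℝ≥0) (x₀ : ℕ → L2 d μ) (p : ℕ → P) (x : ℕ → ℝ≥0 → L2 d μ),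
    Tendsto t atTop atTop ∧ (∀ n, x₀ n ∈ D) ∧ (∀ n, S (x₀ n) (p n) (x n)) ∧
    Tendsto (fun n => toL2w (x n (t n))) atTop (𝓝 y)}

/-- The set `A` attracts `D` in the weak topology, uniformly in the parameter: for every weak
neighbourhood `V` of `0`, the solutions that start in `D` lie in `A + V` from some time on. -/
def WeaklyAttracts {Ω : Type*} [MeasurableSpace Ω] {d : ℕ} {μ : Measure Ω} {P : Type*}
    (S : L2 d μ → P → (ℝ≥0 → L2 d μ) → Prop) (A : Set (L2w d μ)) (D : Set (L2 d μ)) : Prop :=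
  ∀ V ∈ 𝓝 (0 : L2w d μ), ∃ T : ℝ≥0, ∀ x₀ ∈ D, ∀ (p : P) (x : ℝ≥0 → L2 d μ), S x₀ p x →
    ∀ t ≥ T, ∃ a ∈ A, toL2w (x t) - a ∈ V

/-- `D` is a bounded subset of the space `L²(Ω, 𝓕₀; ℝᵈ)` of initial values. -/
def IsBoundedInitialSet {Ω : Type*} [mΩ : MeasurableSpace Ω] {d : ℕ} {μ : Measure Ω}
    (𝓕 : Filtration ℝ≥0 mΩ) (D : Set (L2 d μ)) : Prop :=
  (∀ x ∈ D, AEStronglyMeasurable[𝓕 0] x μ) ∧ Bornology.IsBounded D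

/-- The weak closure `Ω*_p` of the union of all `ω_p(D)`, `D` a bounded set of initial values. -/
def weakOmegaStar {Ω : Type*} [mΩ : MeasurableSpace Ω] {d : ℕ} {μ : Measure Ω} {P : Type*}
    (𝓕 : Filtration ℝ≥0 mΩ) (S : L2 d μ → P → (ℝ≥0 → L2 d μ) → Prop) : Set (L2w d μ) :=
  closure (⋃ (D : Set (L2 d μ)) (_ : IsBoundedInitialSet 𝓕 D), weakOmegaLimit S D)

end

/-! Everything rests on one estimate: each solution satisfies ‖x(t)‖ ≤ K + 2‖x₀‖e^{-ϱt/2}, with K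
independent of the initial value, the parameter and the solution
(`IsMeanLipschitz.exists_isDissipative`). The kernel a(t,·) has mass at most ϱ^{-α}. The drift grows
linearly with slope √L, uniformly in the parameter because P is compact. The noise term is bounded
in L²(Ω) uniformly in t: for H > 1/2 the moving average kernel has an integrable derivative, so
Young's inequality makes the Wiener integral a bounded operator on L², and a(t,·) stays bounded in
L² because α > 1/2. Once ϱ is so large that √L(ϱ/2)^{-α} ≤ 1/2, a Gronwall argument with an
exponential weight (`le_add_exp_of_volterra`) closes the estimate.

The rest is soft analysis in a Hilbert space. Balls are weakly compact and weakly sequentially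
compact, which gives (i) and, by contradiction, attraction. The delicate point is that ω-limit sets
are defined by sequences, whereas the weak topology is not metrizable and L²(Ω) may be nonseparable.
They are nevertheless weakly closed, because a bounded sequence need only be tested against its own
terms and its limit (`exists_seq_tendsto_weak_of_mem_closure`). Nonemptiness also needs a solution,
which a contraction argument provides under the same smallness condition. -/

/-! ### Weak topology of a Hilbert space -/

section WeakHilbert

variable {E : Type*} [NormedAddCommGroup E] [InnerProductSpace ℝ E] [CompleteSpace E]

lemma tendsto_toWeakSpace_iff_inner {ι : Type*} {l : Filter ι} {f : ι → E} {y : E} :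
    Tendsto (fun i => toWeakSpace ℝ E (f i)) l (𝓝 (toWeakSpace ℝ E y)) ↔
      ∀ z : E, Tendsto (fun i => inner ℝ (f i) z) l (𝓝 (inner ℝ y z)) := by
  have hB : Function.Injective ((topDualPairing ℝ E).flip) := by
    intro a b hab
    refine ext_inner_left ℝ fun v => ?_
    have := LinearMap.congr_fun hab (innerSL ℝ v)
    simpa [topDualPairing_apply] using this
  have key := WeakBilin.tendsto_iff_forall_eval_tendsto (B := (topDualPairing ℝ E).flip)
    (l := l) (f := fun i => f i) (x := y) hB
  refine Iff.trans key ⟨fun h z => ?_, fun h φ => ?_⟩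
  · have := h (innerSL ℝ z)
    simpa [topDualPairing_apply, real_inner_comm] using this
  · have hφ : ∀ w : E, inner ℝ w ((InnerProductSpace.toDual ℝ E).symm φ) = φ w := fun w => by
      rw [real_inner_comm, InnerProductSpace.toDual_symm_apply]
    have := h ((InnerProductSpace.toDual ℝ E).symm φ)
    simp only [hφ] at this
    exact this

omit [CompleteSpace E] in
lemma continuous_inner_weakSpace (z : E) :
    Continuous fun x : WeakSpace ℝ E => inner ℝ ((toWeakSpace ℝ E).symm x) z := by
  have h : Continuous fun x : WeakSpace ℝ E => (topDualPairing ℝ E).flip x (innerSL ℝ z) :=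
    WeakBilin.eval_continuous (topDualPairing ℝ E).flip (innerSL ℝ z)
  convert h using 2 with x
  simp [real_inner_comm]
  rfl

omit [CompleteSpace E] in
lemma isClosed_weak_closedBall (r : ℝ) :
    IsClosed (toWeakSpace ℝ E '' Metric.closedBall 0 r) := by
  have h := (convex_closedBall (0 : E) r).toWeakSpace_closure (𝕜 := ℝ)
  rw [Metric.isClosed_closedBall.closure_eq] at h
  rw [h]
  exact isClosed_closure

lemma isCompact_weak_closedBall (r : ℝ) :
    IsCompact (toWeakSpace ℝ E '' Metric.closedBall 0 r) := by
  rw [← (isClosed_weak_closedBall (E := E) r).closure_eq]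
  refine NormedSpace.isCompact_closure_of_isBounded ℝ E _ ?_ ?_
  · rw [(toWeakSpace ℝ E).injective.preimage_image]
    exact Metric.isBounded_closedBall
  · refine fun ψ _ => ?_
    -- Reflexivity: an element of the bidual, pulled back along the Riesz map, is a functional on
    -- `E`, and the vector representing that functional is the required preimage.
    let ℓ : StrongDual ℝ E := (WeakDual.toStrongDual ψ).comp
      (innerSL ℝ)
    refine ⟨toWeakSpace ℝ E ((InnerProductSpace.toDual ℝ E).symm ℓ), ?_⟩
    refine DFunLike.ext _ _ fun φ => ?_
    obtain ⟨w, rfl⟩ := (InnerProductSpace.toDual ℝ E).surjective φ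
    have h1 : inner ℝ ((InnerProductSpace.toDual ℝ E).symm ℓ) w = ℓ w := by
      simp
    have h2 : ℓ w = ψ (InnerProductSpace.toDual ℝ E w) := rfl
    rw [← h2, ← h1, real_inner_comm]
    exact NormedSpace.inclusionInDoubleDualWeak_apply_apply ..

/-- A bounded sequence in a Hilbert space has a weakly convergent subsequence. -/
lemma exists_subseq_tendsto_weak {x : ℕ → E} {r : ℝ} (hx : ∀ n, ‖x n‖ ≤ r) :
    ∃ (y : E) (φ : ℕ → ℕ), StrictMono φ ∧
      Tendsto (fun k => toWeakSpace ℝ E (x (φ k))) atTop (𝓝 (toWeakSpace ℝ E y)) := by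
  -- The closed span of the sequence is separable, so the sequential Banach-Alaoglu theorem applies
  -- in it. An arbitrary test vector can be replaced by its projection onto `F`.
  let F : Submodule ℝ E := (Submodule.span ℝ (range x)).topologicalClosure
  have hF : IsClosed (F : Set E) := Submodule.isClosed_topologicalClosure _
  have : CompleteSpace F := hF.completeSpace_coe
  have : TopologicalSpace.SeparableSpace F := by
    have h : TopologicalSpace.IsSeparable (F : Set E) := by
      rw [Submodule.topologicalClosure_coe]
      exact ((countable_range x).isSeparable.span (R := ℝ)).closure
    exact h.separableSpace
  have hxF : ∀ n, x n ∈ F := fun n =>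
    Submodule.le_topologicalClosure _ (Submodule.subset_span (mem_range_self n))
  let ψ : ℕ → WeakDual ℝ F := fun n =>
    StrongDual.toWeakDual (InnerProductSpace.toDual ℝ F ⟨x n, hxF n⟩)
  have hψ : ∀ n, ψ n ∈ WeakDual.toStrongDual ⁻¹' Metric.closedBall (0 : StrongDual ℝ F) r := by
    intro n
    have : ‖InnerProductSpace.toDual ℝ F ⟨x n, hxF n⟩‖ ≤ r := by
      rw [LinearIsometryEquiv.norm_map]; exact hx n
    exact (mem_closedBall_zero_iff (E := StrongDual ℝ F)).2 this
  obtain ⟨f, -, φ, hφ, hlim⟩ := WeakDual.isSeqCompact_closedBall ℝ F 0 r hψ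
  refine ⟨((InnerProductSpace.toDual ℝ F).symm (WeakDual.toStrongDual f) : F), φ, hφ,
    tendsto_toWeakSpace_iff_inner.2 fun z => ?_⟩
  have h1 := ((WeakDual.eval_continuous (F.orthogonalProjectionOnto z)).tendsto f).comp hlim
  have h2 : ∀ w : F, inner ℝ (w : E) z = inner ℝ w (F.orthogonalProjectionOnto z) := fun w => by
    rw [Submodule.coe_inner]
    exact (Submodule.inner_orthogonalProjectionOnto_eq_of_mem_left w z).symm
  have h3 : inner ℝ ((InnerProductSpace.toDual ℝ F).symm (WeakDual.toStrongDual f))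
      (F.orthogonalProjectionOnto z) = f (F.orthogonalProjectionOnto z) :=
    InnerProductSpace.toDual_symm_apply
  rw [h2, h3]
  refine h1.congr fun n => ?_
  have := h2 ⟨x (φ n), hxF _⟩
  simp only [Function.comp, ψ]
  rw [this]
  simp [StrongDual.toWeakDual_apply]

/-- A bounded sequence in a Hilbert space converges weakly to `y` if its inner products with `y`
and with each of its own terms converge to those of `y`. -/
lemma tendsto_weak_of_tendsto_inner_self {x : ℕ → E} {y : E} {r : ℝ} (hx : ∀ n, ‖x n‖ ≤ r)
    (hy : Tendsto (fun n => inner ℝ (x n - y) y) atTop (𝓝 0))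
    (hxx : ∀ m, Tendsto (fun n => inner ℝ (x n - y) (x m)) atTop (𝓝 0)) :
    Tendsto (fun n => toWeakSpace ℝ E (x n)) atTop (𝓝 (toWeakSpace ℝ E y)) := by
  let S : Submodule ℝ E := Submodule.span ℝ (insert y (range x))
  let F : Submodule ℝ E := S.topologicalClosure
  have hF : IsClosed (F : Set E) := Submodule.isClosed_topologicalClosure _
  have : CompleteSpace F := hF.completeSpace_coe
  have hSF : S ≤ F := Submodule.le_topologicalClosure _
  have hxF : ∀ n, x n ∈ F := fun n =>
    hSF (Submodule.subset_span (mem_insert_of_mem _ (mem_range_self n)))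
  have hyF : y ∈ F := hSF (Submodule.subset_span (mem_insert _ _))
  have hS : ∀ z ∈ S, Tendsto (fun n => inner ℝ (x n - y) z) atTop (𝓝 0) := by
    intro z hz
    induction hz using Submodule.span_induction with
    | mem z hz =>
      rcases hz with rfl | ⟨m, rfl⟩
      · exact hy
      · exact hxx m
    | zero => simp
    | add a b _ _ ha hb => simpa [inner_add_right] using ha.add hb
    | smul c a _ ha => simpa [inner_smul_right] using ha.const_mul c
  have hb : ∀ n, ‖x n - y‖ ≤ r + ‖y‖ := fun n => (norm_sub_le _ _).trans (by gcongr; exact hx n)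
  have hr : 0 ≤ r + ‖y‖ := (norm_nonneg _).trans (hb 0)
  -- Boundedness extends the convergence from the span to its closure; the orthogonal complement of
  -- `F` contributes nothing, since the sequence and `y` lie in `F`.
  have hFt : ∀ z ∈ F, Tendsto (fun n => inner ℝ (x n - y) z) atTop (𝓝 0) := by
    intro z hz
    rw [Metric.tendsto_atTop]
    intro ε hε
    have hz' : z ∈ closure (S : Set E) := by
      rw [← Submodule.topologicalClosure_coe]; exact hz
    obtain ⟨w, hw, hzw⟩ := Metric.mem_closure_iff.1 hz' (ε / 2 / (r + ‖y‖ + 1)) (by positivity)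
    obtain ⟨N, hN⟩ := Metric.tendsto_atTop.1 (hS w hw) (ε / 2) (by positivity)
    refine ⟨N, fun n hn => ?_⟩
    have h1 := hN n hn
    rw [Real.dist_0_eq_abs] at h1 ⊢
    have h2 : inner ℝ (x n - y) z = inner ℝ (x n - y) w + inner ℝ (x n - y) (z - w) := by
      rw [← inner_add_right]; congr 1; abel
    have h3 : |inner ℝ (x n - y) (z - w)| ≤ ε / 2 := by
      refine (abs_real_inner_le_norm _ _).trans ?_
      rw [dist_eq_norm] at hzw
      calc ‖x n - y‖ * ‖z - w‖ ≤ (r + ‖y‖ + 1) * (ε / 2 / (r + ‖y‖ + 1)) := by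
            gcongr
            linarith [hb n]
        _ = ε / 2 := by field_simp
    rw [h2]
    linarith [abs_add_le (inner ℝ (x n - y) w) (inner ℝ (x n - y) (z - w))]
  refine tendsto_toWeakSpace_iff_inner.2 fun z => ?_
  have h1 := hFt _ (F.orthogonalProjectionOnto z).2
  have h2 : ∀ n, inner ℝ (x n - y) (F.orthogonalProjectionOnto z : E) = inner ℝ (x n) z - inner ℝ y z :=
    fun n => by
      rw [← inner_sub_left]
      exact Submodule.inner_orthogonalProjectionOnto_eq_of_mem_left ⟨x n - y, F.sub_mem (hxF n) hyF⟩ z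
  simp only [h2] at h1
  simpa using h1.add_const (inner ℝ y z)

/-- A point in the weak closure of each of the uniformly bounded sets `R n` of a Hilbert space is
the weak limit of a sequence of points of `R n`. -/
lemma exists_seq_tendsto_weak_of_mem_closure {R : ℕ → Set E} {r : ℝ}
    (hR : ∀ n, ∀ z ∈ R n, ‖z‖ ≤ r) {y : E}
    (hy : ∀ n, toWeakSpace ℝ E y ∈ closure (toWeakSpace ℝ E '' R n)) :
    ∃ z : ℕ → E, (∀ n, z n ∈ R n) ∧
      Tendsto (fun n => toWeakSpace ℝ E (z n)) atTop (𝓝 (toWeakSpace ℝ E y)) := by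
  -- Here `T` is any finite set of test vectors. Below it consists of `y` and all previously chosen
  -- points, so each point is tested by every later one with an error tending to zero.
  have step : ∀ (n : ℕ) (T : Finset E), ∃ z ∈ R n, ∀ e ∈ T, |inner ℝ (z - y) e| < 1 / (n + 1) := by
    intro n T
    have hopen : IsOpen (⋂ e ∈ T, {x : WeakSpace ℝ E |
        |inner ℝ ((toWeakSpace ℝ E).symm x) e - inner ℝ y e| < 1 / ((n : ℝ) + 1)}) := by
      refine isOpen_biInter_finset fun e _ => ?_
      exact isOpen_lt ((continuous_inner_weakSpace e).sub continuous_const).abs continuous_const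
    obtain ⟨w, hw, z, hz, rfl⟩ := mem_closure_iff.1 (hy n) _ hopen (by
      simp only [mem_iInter, mem_ofPred_eq, LinearEquiv.symm_apply_apply, sub_self, abs_zero]
      intros; positivity)
    refine ⟨z, hz, fun e he => ?_⟩
    have := mem_iInter₂.1 hw e he
    simpa [inner_sub_left] using this
  classical
  choose f hfR hf using step
  -- the list of the chosen points, the most recent first, is fed back into the choice
  let l : ℕ → List E := fun n => Nat.rec [y] (fun k l => f k l.toFinset :: l) n
  have hl : ∀ n, l (n + 1) = f n (l n).toFinset :: l n := fun n => rfl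
  let z : ℕ → E := fun n => f n (l n).toFinset
  have hmono : ∀ {m n}, m ≤ n → l m ⊆ l n := by
    intro m n hmn
    induction hmn with
    | refl => exact List.Subset.refl _
    | step _ ih => exact List.Subset.trans ih (by rw [hl]; exact List.subset_cons_self _ _)
  have hyl : ∀ n, y ∈ l n := fun n => hmono (Nat.zero_le n) (by simp [l])
  have hzl : ∀ {m n}, m < n → z m ∈ l n := fun {m n} hmn =>
    hmono (Nat.succ_le_of_lt hmn) (by rw [hl]; exact List.mem_cons_self)
  have hlim : Tendsto (fun n : ℕ => 1 / ((n : ℝ) + 1)) atTop (𝓝 0) :=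
    tendsto_one_div_add_atTop_nhds_zero_nat
  refine ⟨z, fun n => hfR _ _, tendsto_weak_of_tendsto_inner_self (r := r)
    (fun n => hR n _ (hfR _ _)) ?_ fun m => ?_⟩
  · refine squeeze_zero_norm (fun n => ?_) hlim
    exact (hf n _ y (by simpa using hyl n)).le
  · refine squeeze_zero_norm' ?_ hlim
    filter_upwards [eventually_gt_atTop m] with n hn
    exact (hf n _ (z m) (by simpa using hzl hn)).le

end WeakHilbert

/-! ### Weak attractors of dissipative solution relations -/

section WeakAttractor

variable {Ω : Type*} [mΩ : MeasurableSpace Ω] {d : ℕ} {μ : Measure Ω} {P : Type*}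
  {S : L2 d μ → P → (ℝ≥0 → L2 d μ) → Prop} {K η : ℝ} {D : Set (L2 d μ)}

/-- A solution relation is dissipative with radius `K` and rate `η` if its solutions enter the
ball of radius `K` exponentially fast. -/
def IsDissipative (S : L2 d μ → P → (ℝ≥0 → L2 d μ) → Prop) (K η : ℝ) : Prop :=
  ∀ x₀ p x, S x₀ p x → ∀ t : ℝ≥0, ‖x t‖ ≤ K + 2 * ‖x₀‖ * Real.exp (-η * t)

lemma IsDissipative.exists_norm_le (hS : IsDissipative S K η) (hη : 0 < η)
    (hD : Bornology.IsBounded D) :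
    ∃ r, ∀ x₀ ∈ D, ∀ p x, S x₀ p x → ∀ t : ℝ≥0, ‖x t‖ ≤ r := by
  obtain ⟨r, hr⟩ := hD.exists_norm_le
  refine ⟨K + 2 * r, fun x₀ hx₀ p x hx t => (hS x₀ p x hx t).trans ?_⟩
  have h1 : Real.exp (-η * t) ≤ 1 := Real.exp_le_one_iff.2 (by
    have := mul_nonneg hη.le t.2
    simpa using this)
  have h2 : 2 * ‖x₀‖ * Real.exp (-η * t) ≤ 2 * ‖x₀‖ * 1 := by gcongr
  linarith [hr x₀ hx₀]

lemma IsDissipative.exists_subseq_tendsto (hS : IsDissipative S K η) (hη : 0 < η)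
    (hD : Bornology.IsBounded D) {t : ℕ → ℝ≥0} {x₀ : ℕ → L2 d μ} {p : ℕ → P}
    {x : ℕ → ℝ≥0 → L2 d μ} (hx₀ : ∀ n, x₀ n ∈ D) (hx : ∀ n, S (x₀ n) (p n) (x n)) :
    ∃ (y : L2w d μ) (φ : ℕ → ℕ), StrictMono φ ∧
      Tendsto (fun k => toL2w (x (φ k) (t (φ k)))) atTop (𝓝 y) := by
  obtain ⟨r, hr⟩ := hS.exists_norm_le hη hD
  obtain ⟨y, φ, hφ, hy⟩ := exists_subseq_tendsto_weak (x := fun n => x n (t n)) (r := r)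
    (fun n => hr _ (hx₀ n) _ _ (hx n) _)
  exact ⟨toL2w y, φ, hφ, hy⟩

lemma IsDissipative.isCompact_closure_range (hS : IsDissipative S K η) (hη : 0 < η)
    (hD : Bornology.IsBounded D) {t : ℕ → ℝ≥0} {x₀ : ℕ → L2 d μ} {p : ℕ → P}
    {x : ℕ → ℝ≥0 → L2 d μ} (hx₀ : ∀ n, x₀ n ∈ D) (hx : ∀ n, S (x₀ n) (p n) (x n)) :
    IsCompact (closure (range fun n => toL2w (x n (t n)))) := by
  obtain ⟨r, hr⟩ := hS.exists_norm_le hη hD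
  refine (isCompact_weak_closedBall (E := L2 d μ) r).of_isClosed_subset isClosed_closure ?_
  refine closure_minimal ?_ (isClosed_weak_closedBall r)
  rintro _ ⟨n, rfl⟩
  exact ⟨_, mem_closedBall_zero_iff.2 (hr _ (hx₀ n) _ _ (hx n) (t n)), rfl⟩

/-- The contribution of the initial value dies out exponentially and closed balls are weakly closed,
so weak limits have norm at most K + ε for every ε. The radius does not depend on `D`, which is what
bounds the union over all `D`. -/
lemma IsDissipative.weakOmegaLimit_subset (hS : IsDissipative S K η) (hη : 0 < η)
    (hD : Bornology.IsBounded D) :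
    weakOmegaLimit S D ⊆ toWeakSpace ℝ (L2 d μ) '' Metric.closedBall 0 K := by
  rintro y ⟨t, x₀, p, x, ht, hx₀, hx, hy⟩
  obtain ⟨r, hr⟩ := hD.exists_norm_le
  obtain ⟨y, rfl⟩ := (toWeakSpace ℝ (L2 d μ)).surjective y
  refine ⟨y, mem_closedBall_zero_iff.2 (le_of_forall_pos_le_add fun ε hε => ?_), rfl⟩
  have hlim : Tendsto (fun n => 2 * r * Real.exp (-η * t n)) atTop (𝓝 0) := by
    have h1 : Tendsto (fun n => η * (t n : ℝ)) atTop atTop :=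
      (NNReal.tendsto_coe_atTop.2 ht).const_mul_atTop hη
    have h2 := (Real.tendsto_exp_neg_atTop_nhds_zero.comp h1).const_mul (2 * r)
    simpa [Function.comp_def] using h2
  have hev : ∀ᶠ n in atTop, toL2w (x n (t n)) ∈
      toWeakSpace ℝ (L2 d μ) '' Metric.closedBall 0 (K + ε) := by
    filter_upwards [hlim.eventually (gt_mem_nhds hε)] with n hn
    refine ⟨_, mem_closedBall_zero_iff.2 ((hS _ _ _ (hx n) (t n)).trans ?_), rfl⟩
    have : 2 * ‖x₀ n‖ * Real.exp (-η * t n) ≤ 2 * r * Real.exp (-η * t n) := by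
      gcongr; exact hr _ (hx₀ n)
    linarith
  obtain ⟨z, hz, hzy⟩ := (isClosed_weak_closedBall (E := L2 d μ) (K + ε)).mem_of_tendsto hy hev
  rw [(toWeakSpace ℝ (L2 d μ)).injective hzy] at hz
  exact mem_closedBall_zero_iff.1 hz

/-- A point of the weak closure lies in the weak closure of every tail set `R n` of states reached
at times at least `n`. All tails lie in one ball, so a sequence with one state from each tail
converges weakly to the point, and its times tend to infinity. -/
lemma IsDissipative.isClosed_weakOmegaLimit (hS : IsDissipative S K η) (hη : 0 < η)
    (hD : Bornology.IsBounded D) : IsClosed (weakOmegaLimit S D) := by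
  refine isClosed_of_closure_subset fun y hy => ?_
  obtain ⟨y, rfl⟩ := (toWeakSpace ℝ (L2 d μ)).surjective y
  let R : ℕ → Set (L2 d μ) := fun n =>
    {z | ∃ x₀ ∈ D, ∃ p x, S x₀ p x ∧ ∃ t : ℝ≥0, (n : ℝ≥0) ≤ t ∧ x t = z}
  obtain ⟨r, hr⟩ := hS.exists_norm_le hη hD
  have hR : ∀ n, ∀ z ∈ R n, ‖z‖ ≤ r := by
    rintro n _ ⟨x₀, hx₀, p, x, hx, t, -, rfl⟩
    exact hr _ hx₀ _ _ hx t
  have hω : ∀ n, weakOmegaLimit S D ⊆ closure (toWeakSpace ℝ (L2 d μ) '' R n) := by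
    rintro n z ⟨t, x₀, p, x, ht, hx₀, hx, hz⟩
    refine mem_closure_of_tendsto hz ?_
    filter_upwards [ht.eventually_ge_atTop (n : ℝ≥0)] with k hk
    exact ⟨_, ⟨x₀ k, hx₀ k, p k, x k, hx k, t k, hk, rfl⟩, rfl⟩
  obtain ⟨z, hz, hzy⟩ := exists_seq_tendsto_weak_of_mem_closure hR
    (fun n => closure_minimal (hω n) isClosed_closure hy)
  choose x₀ hx₀ p x hx t ht hxt using hz
  refine ⟨t, x₀, p, x, tendsto_atTop_mono ht tendsto_natCast_atTop_atTop, hx₀, hx, ?_⟩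
  refine hzy.congr fun n => ?_
  rw [hxt]
  rfl

lemma IsDissipative.isCompact_weakOmegaLimit (hS : IsDissipative S K η) (hη : 0 < η)
    (hD : Bornology.IsBounded D) : IsCompact (weakOmegaLimit S D) :=
  (isCompact_weak_closedBall (E := L2 d μ) K).of_isClosed_subset
    (hS.isClosed_weakOmegaLimit hη hD) (hS.weakOmegaLimit_subset hη hD)

/-- If attraction failed, there would be states at times tɴ ≥ N outside the given neighbourhood of
the limit set; a weakly convergent subsequence of them has its limit in that set. -/
lemma IsDissipative.weaklyAttracts_weakOmegaLimit (hS : IsDissipative S K η) (hη : 0 < η)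
    (hD : Bornology.IsBounded D) : WeaklyAttracts S (weakOmegaLimit S D) D := by
  intro V hV
  by_contra! hcon
  have hcon' := fun n : ℕ => hcon (n : ℝ≥0)
  choose x₀ hx₀ p x hx t ht hxt using hcon'
  have htop : Tendsto t atTop atTop := tendsto_atTop_mono ht tendsto_natCast_atTop_atTop
  obtain ⟨y, φ, hφ, hy⟩ := hS.exists_subseq_tendsto (t := t) hη hD hx₀ hx
  have hyω : y ∈ weakOmegaLimit S D :=
    ⟨t ∘ φ, x₀ ∘ φ, p ∘ φ, x ∘ φ, htop.comp hφ.tendsto_atTop, fun n => hx₀ _, fun n => hx _, hy⟩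
  have h0 : Tendsto (fun k => toL2w (x (φ k) (t (φ k))) - y) atTop (𝓝 0) := by
    have := hy.sub_const y
    rwa [sub_self] at this
  obtain ⟨k, hk⟩ := (h0.eventually_mem hV).exists
  exact hxt (φ k) y hyω hk

lemma IsDissipative.weakOmegaLimit_nonempty (hS : IsDissipative S K η) (hη : 0 < η)
    (hD : Bornology.IsBounded D) {x₀ : L2 d μ} (hx₀ : x₀ ∈ D) {p : P} {x : ℝ≥0 → L2 d μ}
    (hx : S x₀ p x) : (weakOmegaLimit S D).Nonempty := by
  obtain ⟨y, φ, hφ, hy⟩ := hS.exists_subseq_tendsto (t := fun n : ℕ => (n : ℝ≥0))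
    (x₀ := fun _ => x₀) (p := fun _ => p) (x := fun _ => x) hη hD (fun _ => hx₀) (fun _ => hx)
  exact ⟨y, fun n => (φ n : ℝ≥0), fun _ => x₀, fun _ => p, fun _ => x,
    tendsto_natCast_atTop_atTop.comp hφ.tendsto_atTop, fun _ => hx₀, fun _ => hx, hy⟩

lemma WeaklyAttracts.weakOmegaLimit_subset {A : Set (L2w d μ)} (hA : WeaklyAttracts S A D)
    (hcl : IsClosed A) : weakOmegaLimit S D ⊆ A := by
  rintro y ⟨t, x₀, p, x, ht, hx₀, hx, hy⟩
  rw [← hcl.closure_eq, mem_closure_iff_nhds_zero]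
  intro U hU
  have hadd : Tendsto (fun q : L2w d μ × L2w d μ => q.1 - q.2) (𝓝 (0, 0)) (𝓝 0) := by
    have : Continuous fun q : L2w d μ × L2w d μ => q.1 - q.2 := continuous_sub
    simpa using this.tendsto (0, 0)
  -- With x = xₙ(tₙ), the identity (x − y) − (x − a) = a − y uses `V` for convergence and `W` for
  -- attraction.
  obtain ⟨V, hV, W, hW, hVW⟩ := mem_nhds_prod_iff.1 (hadd hU)
  obtain ⟨T, hT⟩ := hA W hW
  have h0 : Tendsto (fun n => toL2w (x n (t n)) - y) atTop (𝓝 0) := by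
    have := hy.sub_const y
    rwa [sub_self] at this
  obtain ⟨n, hn, hnT⟩ := ((h0.eventually_mem hV).and (ht.eventually_ge_atTop T)).exists
  obtain ⟨a, ha, haW⟩ := hT _ (hx₀ n) _ _ (hx n) _ hnT
  refine ⟨a, ha, ?_⟩
  have h1 := hVW (mk_mem_prod hn haW)
  simpa using h1

lemma WeaklyAttracts.mono {A A' : Set (L2w d μ)} (hA : WeaklyAttracts S A D) (h : A ⊆ A') :
    WeaklyAttracts S A' D := fun V hV => by
  obtain ⟨T, hT⟩ := hA V hV
  refine ⟨T, fun x₀ hx₀ p x hx t ht => ?_⟩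
  obtain ⟨a, ha, haV⟩ := hT x₀ hx₀ p x hx t ht
  exact ⟨a, h ha, haV⟩

variable {𝓕 : Filtration ℝ≥0 mΩ}

lemma IsDissipative.weakOmegaStar_subset (hS : IsDissipative S K η) (hη : 0 < η) :
    weakOmegaStar 𝓕 S ⊆ toWeakSpace ℝ (L2 d μ) '' Metric.closedBall 0 K :=
  closure_minimal (iUnion₂_subset fun _ hD => hS.weakOmegaLimit_subset hη hD.2)
    (isClosed_weak_closedBall K)

lemma IsDissipative.isBounded_weakOmegaStar (hS : IsDissipative S K η) (hη : 0 < η) :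
    Bornology.IsBounded (toL2w ⁻¹' weakOmegaStar 𝓕 S) := by
  refine (Metric.isBounded_closedBall (x := (0 : L2 d μ)) (r := K)).subset fun x hx => ?_
  obtain ⟨z, hz, hzx⟩ := hS.weakOmegaStar_subset hη hx
  rwa [(toWeakSpace ℝ (L2 d μ)).injective hzx] at hz

lemma IsDissipative.isCompact_weakOmegaStar (hS : IsDissipative S K η) (hη : 0 < η) :
    IsCompact (weakOmegaStar 𝓕 S) :=
  (isCompact_weak_closedBall (E := L2 d μ) K).of_isClosed_subset isClosed_closure
    (hS.weakOmegaStar_subset hη)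

lemma IsDissipative.isLeast_weakOmegaStar (hS : IsDissipative S K η) (hη : 0 < η) :
    IsLeast {A : Set (L2w d μ) | IsClosed A ∧
        ∀ D : Set (L2 d μ), IsBoundedInitialSet 𝓕 D → WeaklyAttracts S A D}
      (weakOmegaStar 𝓕 S) := by
  refine ⟨⟨isClosed_closure, fun D hD => ?_⟩, fun A hA => ?_⟩
  · exact (hS.weaklyAttracts_weakOmegaLimit hη hD.2).mono
      ((subset_iUnion₂ (s := fun D _ => weakOmegaLimit S D) D hD).trans subset_closure)
  · exact closure_minimal
      (iUnion₂_subset fun D hD => (hA.2 D hD).weakOmegaLimit_subset hA.1) hA.1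

end WeakAttractor

/-! ### The memory kernel in L¹ and L² -/

section Kernel

/-- The maps s ↦ t − s preserve Lebesgue measure and depend continuously on t, so they act strongly
continuously on Lᵖ for finite p. -/
lemma tendsto_eLpNorm_comp_sub_left_sub {f : ℝ → ℝ} {p : ℝ≥0∞} [Fact (1 ≤ p)] (hp : p ≠ ∞)
    (hf : MemLp f p volume) (t : ℝ) :
    Tendsto (fun t' => eLpNorm (fun s => f (t' - s) - f (t - s)) p volume) (𝓝 t) (𝓝 0) := by
  let g : ℝ → C(ℝ, ℝ) := fun t => ⟨fun s => t - s, by fun_prop⟩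
  have hg : Continuous g := ContinuousMap.continuous_of_continuous_uncurry _ (by
    simp only [g, Function.uncurry_def, ContinuousMap.coe_mk]; fun_prop)
  have hgm : ∀ t, MeasurePreserving (g t) volume volume := fun t =>
    Measure.measurePreserving_sub_left volume t
  have hcont : Continuous fun t => Lp.compMeasurePreserving (g t) (hgm t) (hf.toLp f) :=
    Continuous.compMeasurePreservingLp continuous_const hg hgm hp
  have h1 := (hcont.tendsto t).edist (tendsto_const_nhds
    (x := Lp.compMeasurePreserving (g t) (hgm t) (hf.toLp f)))
  rw [edist_self] at h1
  refine h1.congr fun t' => ?_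
  rw [Lp.edist_def]
  refine eLpNorm_congr_ae ?_
  have key : ∀ r, Lp.compMeasurePreserving (g r) (hgm r) (hf.toLp f) =ᵐ[volume]
      fun s => f (r - s) := fun r =>
    (Lp.coeFn_compMeasurePreserving _ (hgm r)).trans
      ((hgm r).quasiMeasurePreserving.ae_eq_comp hf.coeFn_toLp)
  filter_upwards [key t', key t] with s h1 h2
  rw [Pi.sub_apply, ← h1, ← h2]

/-- The density `u^{α-1} e^{-ϱu} / Γ(α)` on `(0, ∞)`, of which `memoryKernel` is the translate. -/
noncomputable def memoryDensity (α ϱ : ℝ) : ℝ → ℝ :=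
  (Ioi 0).indicator fun u => 1 / Real.Gamma α * u ^ (α - 1) * Real.exp (-ϱ * u)

variable {α ϱ : ℝ}

lemma memoryKernel_eq_memoryDensity {t s : ℝ} (h : s < t) :
    memoryKernel α ϱ t s = memoryDensity α ϱ (t - s) := by
  rw [memoryDensity, indicator_of_mem (mem_Ioi.2 (sub_pos.2 h)), memoryKernel]

lemma memoryDensity_nonneg (hα : 0 < α) (u : ℝ) : 0 ≤ memoryDensity α ϱ u := by
  refine indicator_nonneg (fun u hu => ?_) u
  have := Real.Gamma_pos_of_pos hα
  have hu : 0 < u := hu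
  positivity

lemma memoryKernel_nonneg (hα : 0 < α) {t s : ℝ} (h : s ≤ t) : 0 ≤ memoryKernel α ϱ t s := by
  have := Real.Gamma_pos_of_pos hα
  have hu : 0 ≤ t - s := sub_nonneg.2 h
  unfold memoryKernel
  positivity

lemma integrable_memoryDensity (hα : 0 < α) (hϱ : 0 < ϱ) : Integrable (memoryDensity α ϱ) := by
  rw [memoryDensity, integrable_indicator_iff measurableSet_Ioi]
  have h := (integrableOn_rpow_mul_exp_neg_mul_rpow (s := α - 1) (p := 1) (b := ϱ) (by linarith)
    one_pos hϱ).const_mul (1 / Real.Gamma α)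
  refine IntegrableOn.congr_fun h (fun u _ => ?_) measurableSet_Ioi
  simp only [Real.rpow_one]
  ring

/-- This mass tends to zero as ϱ grows, and that decay is the source of all smallness in the proof.
-/
lemma integral_memoryDensity (hα : 0 < α) (hϱ : 0 < ϱ) : ∫ u, memoryDensity α ϱ u = ϱ ^ (-α) := by
  have hΓ := Real.Gamma_pos_of_pos hα
  rw [memoryDensity, integral_indicator measurableSet_Ioi]
  simp only [mul_assoc]
  rw [integral_const_mul]
  simp only [neg_mul]
  rw [Real.integral_rpow_mul_exp_neg_mul_Ioi hα hϱ, Real.rpow_neg hϱ.le, one_div, one_div,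
    Real.inv_rpow hϱ.le]
  field_simp

lemma measurable_memoryDensity : Measurable (memoryDensity α ϱ) := by
  unfold memoryDensity
  exact Measurable.indicator (by fun_prop) measurableSet_Ioi

/-- The square behaves like u^{2α-2} near 0, and 2α − 2 > −1 means α > 1/2. -/
lemma memLp_two_memoryDensity (hα : 1 / 2 < α) (hϱ : 0 < ϱ) :
    MemLp (memoryDensity α ϱ) 2 volume := by
  rw [memLp_two_iff_integrable_sq measurable_memoryDensity.aestronglyMeasurable]
  have h : (fun u => memoryDensity α ϱ u ^ 2) = (Ioi 0).indicator fun u =>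
      (1 / Real.Gamma α) ^ 2 * (u ^ (2 * α - 2) * Real.exp (-(2 * ϱ) * u ^ (1 : ℝ))) := by
    ext u
    by_cases hu : u ∈ Ioi (0 : ℝ)
    · rw [memoryDensity, indicator_of_mem hu, indicator_of_mem hu, mul_pow, mul_pow,
        ← Real.rpow_natCast (u ^ (α - 1)), ← Real.rpow_mul (le_of_lt hu), ← Real.exp_nat_mul,
        mul_assoc, Real.rpow_one]
      push_cast
      ring_nf
    · rw [memoryDensity, indicator_of_notMem hu, indicator_of_notMem hu]; simp
  rw [h, integrable_indicator_iff measurableSet_Ioi]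
  exact (integrableOn_rpow_mul_exp_neg_mul_rpow (by linarith) one_pos (by linarith)).const_mul _

lemma integrableOn_memoryKernel (hα : 0 < α) (hϱ : 0 < ϱ) (t : ℝ) :
    IntegrableOn (memoryKernel α ϱ t) (Ioc 0 t) := by
  rw [integrableOn_Ioc_iff_integrableOn_Ioo]
  have h : IntegrableOn (fun s => memoryDensity α ϱ (t - s)) (Ioo 0 t) :=
    ((integrable_memoryDensity hα hϱ).comp_sub_left t).integrableOn
  exact h.congr_fun (fun s hs => (memoryKernel_eq_memoryDensity hs.2).symm) measurableSet_Ioo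

lemma intervalIntegrable_memoryKernel (hα : 0 < α) (hϱ : 0 < ϱ) {t : ℝ} (ht : 0 ≤ t) :
    IntervalIntegrable (memoryKernel α ϱ t) volume 0 t :=
  (intervalIntegrable_iff_integrableOn_Ioc_of_le ht).2 (integrableOn_memoryKernel hα hϱ t)

lemma integral_memoryKernel_le (hα : 0 < α) (hϱ : 0 < ϱ) {t : ℝ} (ht : 0 ≤ t) :
    ∫ s in (0 : ℝ)..t, memoryKernel α ϱ t s ≤ ϱ ^ (-α) := by
  rw [intervalIntegral.integral_of_le ht, integral_Ioc_eq_integral_Ioo,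
    setIntegral_congr_fun measurableSet_Ioo
      (fun s hs => memoryKernel_eq_memoryDensity (α := α) (ϱ := ϱ) hs.2),
    ← integral_memoryDensity hα hϱ, ← integral_sub_left_eq_self (memoryDensity α ϱ) volume t]
  exact setIntegral_le_integral ((integrable_memoryDensity hα hϱ).comp_sub_left t)
    (ae_of_all _ fun s => memoryDensity_nonneg hα _)

/-- The kernel `a(t, ·)` cut off to `(0, t]`. -/
noncomputable def cutKernel (α ϱ t : ℝ) : ℝ → ℝ := (Ioc 0 t).indicator (memoryKernel α ϱ t)

/-- On a half-line that does not depend on t the kernel is a translate, so continuity in t reduces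
to continuity of translations. At s = t equality can fail: for α = 1 and t > 0 the kernel equals 1
there, while the density vanishes at 0. -/
lemma cutKernel_ae_eq (t : ℝ) :
    cutKernel α ϱ t =ᵐ[volume] (Ioi 0).indicator fun s => memoryDensity α ϱ (t - s) := by
  have hne : ∀ᵐ s : ℝ, s ≠ t := by simp [ae_iff]
  filter_upwards [hne] with s hs
  rw [cutKernel]
  rcases lt_or_gt_of_ne hs with h | h
  · by_cases h0 : 0 < s
    · rw [indicator_of_mem (show s ∈ Ioc 0 t from ⟨h0, h.le⟩),
        indicator_of_mem (mem_Ioi.2 h0), memoryKernel_eq_memoryDensity h]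
    · rw [indicator_of_notMem (fun hs => h0 hs.1), indicator_of_notMem (show s ∉ Ioi (0 : ℝ) from h0)]
  · rw [indicator_of_notMem (fun hs => h.not_ge hs.2)]
    by_cases h0 : 0 < s
    · rw [indicator_of_mem (mem_Ioi.2 h0), memoryDensity, indicator_of_notMem]
      exact fun hs => (sub_pos.1 hs).not_gt h
    · rw [indicator_of_notMem (show s ∉ Ioi (0 : ℝ) from h0)]

lemma tendsto_eLpNorm_cutKernel_sub {p : ℝ≥0∞} [Fact (1 ≤ p)] (hp : p ≠ ∞)
    (h : MemLp (memoryDensity α ϱ) p volume) (t : ℝ) :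
    Tendsto (fun t' => eLpNorm (cutKernel α ϱ t' - cutKernel α ϱ t) p volume) (𝓝 t) (𝓝 0) := by
  refine tendsto_of_tendsto_of_tendsto_of_le_of_le tendsto_const_nhds
    (tendsto_eLpNorm_comp_sub_left_sub hp h t) (fun _ => zero_le) fun t' => ?_
  refine eLpNorm_mono_ae ?_
  filter_upwards [cutKernel_ae_eq (α := α) (ϱ := ϱ) t, cutKernel_ae_eq (α := α) (ϱ := ϱ) t']
    with s h1 h2
  rw [Pi.sub_apply, h1, h2]
  by_cases h0 : 0 < s
  · rw [indicator_of_mem (mem_Ioi.2 h0), indicator_of_mem (mem_Ioi.2 h0)]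
  · rw [indicator_of_notMem (show s ∉ Ioi (0 : ℝ) from h0), indicator_of_notMem (show s ∉ Ioi (0 : ℝ) from h0)]
    simp

lemma eLpNorm_cutKernel_le (p : ℝ≥0∞) (t : ℝ) :
    eLpNorm (cutKernel α ϱ t) p volume ≤ eLpNorm (memoryDensity α ϱ) p volume := by
  rw [← eLpNorm_comp_measurePreserving (f := fun s : ℝ => t - s)
    measurable_memoryDensity.aestronglyMeasurable (Measure.measurePreserving_sub_left volume t)]
  refine eLpNorm_mono_ae ?_
  filter_upwards [cutKernel_ae_eq (α := α) (ϱ := ϱ) t] with s h1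
  rw [h1]
  exact norm_indicator_le_norm_self _ _

lemma memLp_two_cutKernel (hα : 1 / 2 < α) (hϱ : 0 < ϱ) (t : ℝ) :
    MemLp (cutKernel α ϱ t) 2 volume := by
  refine ⟨?_, (eLpNorm_cutKernel_le 2 t).trans_lt (memLp_two_memoryDensity hα hϱ).2⟩
  refine (Measurable.indicator ?_ measurableSet_Ioc).aestronglyMeasurable
  unfold memoryKernel
  fun_prop

end Kernel

/-! ### Increments of tempered fractional Brownian motion -/

section TemperedFBM

lemma eLpNorm_two_sq {β E : Type*} [MeasurableSpace β] [NormedAddCommGroup E] (ν : Measure β)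
    (f : β → E) : eLpNorm f 2 ν ^ 2 = ∫⁻ x, ‖f x‖ₑ ^ 2 ∂ν := by
  have h := eLpNorm_nnreal_pow_eq_lintegral (μ := ν) (f := f) (p := 2) two_ne_zero
  have h2 : ((2 : ℝ≥0) : ℝ) = ((2 : ℕ) : ℝ) := by norm_num
  simpa only [h2, ENNReal.rpow_natCast, ENNReal.coe_ofNat] using h

/-- Young's inequality for the convolution of an `L²` with an `L¹` function. -/
lemma lintegral_sq_lintegral_mul_comp_sub_le {f ψ : ℝ → ℝ≥0∞} (hf : Measurable f)
    (hψ : Measurable ψ) :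
    ∫⁻ x, (∫⁻ s, f s * ψ (s - x)) ^ 2 ≤ (∫⁻ u, ψ u) ^ 2 * ∫⁻ s, f s ^ 2 := by
  have hsq : ∀ a : ℝ≥0∞, (a ^ (1 / 2 : ℝ)) ^ 2 = a := fun a => by
    rw [← ENNReal.rpow_natCast, ← ENNReal.rpow_mul]; norm_num
  have hshift : ∀ x, ∫⁻ s, ψ (s - x) = ∫⁻ u, ψ u := fun x => lintegral_sub_right_eq_self ψ x
  have hshift' : ∀ s, ∫⁻ x, ψ (s - x) = ∫⁻ u, ψ u := fun s => lintegral_sub_left_eq_self ψ s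
  -- Cauchy-Schwarz after splitting ψ into two square roots; Tonelli's theorem then finishes.
  have h1 : ∀ x, (∫⁻ s, f s * ψ (s - x)) ^ 2 ≤ (∫⁻ s, f s ^ 2 * ψ (s - x)) * ∫⁻ u, ψ u := by
    intro x
    have hm : Measurable fun s => ψ (s - x) := hψ.comp (measurable_id.sub_const x)
    have h := ENNReal.lintegral_mul_le_Lp_mul_Lq volume Real.HolderConjugate.two_two
      (f := fun s => f s * ψ (s - x) ^ (1 / 2 : ℝ)) (g := fun s => ψ (s - x) ^ (1 / 2 : ℝ))
      (hf.mul (hm.pow_const _)).aemeasurable (hm.pow_const _).aemeasurable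
    have h2 : ∀ s, ((fun s => f s * ψ (s - x) ^ (1 / 2 : ℝ)) * fun s => ψ (s - x) ^ (1 / 2 : ℝ)) s
        = f s * ψ (s - x) := fun s => by
      rw [Pi.mul_apply, mul_assoc, ← pow_two, hsq]
    have h3 : ∀ s, (f s * ψ (s - x) ^ (1 / 2 : ℝ)) ^ (2 : ℝ) = f s ^ 2 * ψ (s - x) := fun s => by
      rw [ENNReal.rpow_two, mul_pow, hsq]
    have h4 : ∀ s, (ψ (s - x) ^ (1 / 2 : ℝ)) ^ (2 : ℝ) = ψ (s - x) := fun s => by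
      rw [ENNReal.rpow_two, hsq]
    simp only [h2, h3, h4, hshift] at h
    calc (∫⁻ s, f s * ψ (s - x)) ^ 2
        ≤ ((∫⁻ s, f s ^ 2 * ψ (s - x)) ^ (1 / 2 : ℝ) * (∫⁻ u, ψ u) ^ (1 / 2 : ℝ)) ^ 2 := by
          gcongr
      _ = _ := by rw [mul_pow, hsq, hsq]
  have hm2 : Measurable fun q : ℝ × ℝ => f q.2 ^ 2 * ψ (q.2 - q.1) := by fun_prop
  calc ∫⁻ x, (∫⁻ s, f s * ψ (s - x)) ^ 2
      ≤ ∫⁻ x, (∫⁻ s, f s ^ 2 * ψ (s - x)) * ∫⁻ u, ψ u := lintegral_mono h1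
    _ = (∫⁻ x, ∫⁻ s, f s ^ 2 * ψ (s - x)) * ∫⁻ u, ψ u :=
        lintegral_mul_const _ hm2.lintegral_prod_right
    _ = (∫⁻ s, ∫⁻ x, f s ^ 2 * ψ (s - x)) * ∫⁻ u, ψ u := by
        rw [lintegral_lintegral_swap hm2.aemeasurable]
    _ = (∫⁻ s, f s ^ 2 * ∫⁻ u, ψ u) * ∫⁻ u, ψ u := by
        congr 2 with s
        rw [lintegral_const_mul _ (by fun_prop : Measurable fun x => ψ (s - x)), hshift']
    _ = _ := by
        rw [lintegral_mul_const _ (hf.pow_const 2)]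
        ring

lemma integral_sq_sum {ι β : Type*} [MeasurableSpace β] {ν : Measure β} {X : ι → β → ℝ}
    (hX : ∀ i, MemLp (X i) 2 ν) (s : Finset ι) (c : ι → ℝ) :
    ∫ x, (∑ i ∈ s, c i * X i x) ^ 2 ∂ν =
      ∑ i ∈ s, ∑ j ∈ s, c i * c j * ∫ x, X i x * X j x ∂ν := by
  have hint : ∀ i j, Integrable (fun x => c i * c j * (X i x * X j x)) ν := fun i j =>
    ((hX i).integrable_mul (hX j)).const_mul _
  have hexp : ∀ x, (∑ i ∈ s, c i * X i x) ^ 2 = ∑ i ∈ s, ∑ j ∈ s, c i * c j * (X i x * X j x) :=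
    fun x => by
      rw [pow_two, Finset.sum_mul_sum]
      exact Finset.sum_congr rfl fun i _ => Finset.sum_congr rfl fun j _ => by ring
  simp only [hexp]
  rw [integral_finsetSum _ fun i _ => integrable_finsetSum _ fun j _ => hint i j]
  refine Finset.sum_congr rfl fun i _ => ?_
  rw [integral_finsetSum _ fun j _ => hint i j]
  exact Finset.sum_congr rfl fun j _ => integral_const_mul _ _

/-- The L² norm of a linear combination depends only on the Gram matrix. This transfers norms on Ω
to norms of deterministic functions on ℝ. -/
lemma integral_sq_sum_congr {ι β γ : Type*} [MeasurableSpace β] [MeasurableSpace γ]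
    {ν : Measure β} {ρ : Measure γ} {X : ι → β → ℝ} {Z : ι → γ → ℝ} (hX : ∀ i, MemLp (X i) 2 ν)
    (hZ : ∀ i, MemLp (Z i) 2 ρ) (h : ∀ i j, ∫ x, X i x * X j x ∂ν = ∫ x, Z i x * Z j x ∂ρ)
    (s : Finset ι) (c : ι → ℝ) :
    ∫ x, (∑ i ∈ s, c i * X i x) ^ 2 ∂ν = ∫ x, (∑ i ∈ s, c i * Z i x) ^ 2 ∂ρ := by
  rw [integral_sq_sum hX, integral_sq_sum hZ]
  simp only [h]

/-- The function `u ↦ e^{-λ u₊} u₊^{H-1/2}`. -/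
noncomputable def temperedPower (H lam u : ℝ) : ℝ :=
  Real.exp (-lam * max u 0) * max u 0 ^ (H - 1 / 2)

/-- The derivative of `temperedPower` away from `0`. -/
noncomputable def temperedPowerDeriv (H lam : ℝ) : ℝ → ℝ :=
  (Ioi 0).indicator fun u => (H - 1 / 2) * (u ^ (H - 3 / 2) * Real.exp (-lam * u ^ (1 : ℝ))) -
    lam * (u ^ (H - 1 / 2) * Real.exp (-lam * u ^ (1 : ℝ)))

variable {H lam : ℝ}

lemma tfbmKernel_eq (t x : ℝ) :
    tfbmKernel H lam t x = temperedPower H lam (t - x) - temperedPower H lam (0 - x) := by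
  rw [tfbmKernel, temperedPower, temperedPower, zero_sub]

lemma continuous_temperedPower (hH : 1 / 2 < H) : Continuous (temperedPower H lam) := by
  unfold temperedPower
  have h1 : Continuous fun u : ℝ => max u 0 ^ (H - 1 / 2) :=
    (continuous_id.max continuous_const).rpow_const fun _ => Or.inr (by linarith)
  exact (by fun_prop : Continuous fun u : ℝ => Real.exp (-lam * max u 0)).mul h1

lemma temperedPower_of_nonpos (hH : 1 / 2 < H) {u : ℝ} (hu : u ≤ 0) :
    temperedPower H lam u = 0 := by
  rw [temperedPower, max_eq_right hu, Real.zero_rpow (by linarith), mul_zero]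

lemma memLp_two_temperedPower (hH : 1 / 2 < H) (hlam : 0 < lam) :
    MemLp (temperedPower H lam) 2 volume := by
  rw [memLp_two_iff_integrable_sq (continuous_temperedPower hH).aestronglyMeasurable]
  have h : (fun u => temperedPower H lam u ^ 2) = (Ioi 0).indicator fun u =>
      u ^ (2 * H - 1) * Real.exp (-(2 * lam) * u ^ (1 : ℝ)) := by
    ext u
    by_cases hu : u ∈ Ioi (0 : ℝ)
    · rw [indicator_of_mem hu, temperedPower, max_eq_left (le_of_lt hu), mul_pow,
        ← Real.rpow_natCast (u ^ (H - 1 / 2)), ← Real.rpow_mul (le_of_lt hu), ← Real.exp_nat_mul,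
        Real.rpow_one]
      push_cast
      ring_nf
    · rw [indicator_of_notMem hu, temperedPower_of_nonpos hH (not_lt.1 hu)]; simp
  rw [h, integrable_indicator_iff measurableSet_Ioi]
  exact integrableOn_rpow_mul_exp_neg_mul_rpow (by linarith) one_pos (by linarith)

lemma measurable_temperedPowerDeriv : Measurable (temperedPowerDeriv H lam) := by
  unfold temperedPowerDeriv
  exact Measurable.indicator (by fun_prop) measurableSet_Ioi

/-- Near 0 the exponent H − 3/2 exceeds −1 because H > 1/2; at infinity the tempering gives
exponential decay. -/
lemma integrable_temperedPowerDeriv (hH : 1 / 2 < H) (hlam : 0 < lam) :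
    Integrable (temperedPowerDeriv H lam) := by
  rw [temperedPowerDeriv, integrable_indicator_iff measurableSet_Ioi]
  exact ((integrableOn_rpow_mul_exp_neg_mul_rpow (by linarith) one_pos hlam).const_mul _).sub
    ((integrableOn_rpow_mul_exp_neg_mul_rpow (by linarith) one_pos hlam).const_mul _)

lemma hasDerivAt_temperedPower (hH : 1 / 2 < H) {u : ℝ} (hu : u ≠ 0) :
    HasDerivAt (temperedPower H lam) (temperedPowerDeriv H lam u) u := by
  rcases lt_or_gt_of_ne hu with h | h
  · rw [temperedPowerDeriv, indicator_of_notMem (show u ∉ Ioi (0 : ℝ) from not_lt.2 h.le)]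
    refine (hasDerivAt_const u (0 : ℝ)).congr_of_eventuallyEq ?_
    filter_upwards [gt_mem_nhds h] with v hv
    exact temperedPower_of_nonpos hH (le_of_lt hv)
  · rw [temperedPowerDeriv, indicator_of_mem (mem_Ioi.2 h)]
    have h1 : HasDerivAt (fun v : ℝ => Real.exp (-lam * v) * v ^ (H - 1 / 2))
        (Real.exp (-lam * u) * (-lam * 1) * u ^ (H - 1 / 2) +
          Real.exp (-lam * u) * ((H - 1 / 2) * u ^ (H - 1 / 2 - 1))) u :=
      (((hasDerivAt_id u).const_mul (-lam)).exp).mul (Real.hasDerivAt_rpow_const (Or.inl hu))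
    have h2 : temperedPower H lam =ᶠ[𝓝 u] fun v : ℝ => Real.exp (-lam * v) * v ^ (H - 1 / 2) := by
      filter_upwards [lt_mem_nhds h] with v hv
      rw [temperedPower, max_eq_left (le_of_lt hv)]
    refine (h1.congr_of_eventuallyEq h2).congr_deriv ?_
    rw [Real.rpow_one, show H - 1 / 2 - 1 = H - 3 / 2 by ring]
    ring

/-- The derivative may blow up at 0, but the function is continuous there and the derivative is
integrable, so the fundamental theorem of calculus survives. The form with an indicator exhibits a
convolution. -/
lemma temperedPower_sub (hH : 1 / 2 < H) (hlam : 0 < lam) {u v : ℝ} (huv : u ≤ v) (x : ℝ) :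
    temperedPower H lam (v - x) - temperedPower H lam (u - x) =
      ∫ s, (Ioc u v).indicator (fun _ => (1 : ℝ)) s * temperedPowerDeriv H lam (s - x) := by
  have h1 := integral_eq_of_hasDerivAt_off_countable (temperedPower H lam)
    (temperedPowerDeriv H lam) (a := u - x) (b := v - x) (s := {0}) (countable_singleton 0)
    (continuous_temperedPower hH).continuousOn (fun y hy => hasDerivAt_temperedPower hH hy.2)
    (integrable_temperedPowerDeriv hH hlam).intervalIntegrable
  rw [← h1, ← intervalIntegral.integral_comp_sub_right (temperedPowerDeriv H lam) x,
    intervalIntegral.integral_of_le huv, ← integral_indicator measurableSet_Ioc]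
  congr 1 with s
  by_cases hs : s ∈ Ioc u v
  · rw [indicator_of_mem hs, indicator_of_mem hs, one_mul]
  · rw [indicator_of_notMem hs, indicator_of_notMem hs, zero_mul]

/-- A combination of increments of `temperedPower` has an `L²` norm that is bounded by the norm of
the corresponding step function. -/
lemma lintegral_sq_sum_temperedPower_le (hH : 1 / 2 < H) (hlam : 0 < lam) {ι : Type*}
    (s : Finset ι) (c : ι → ℝ) {u v : ι → ℝ} (huv : ∀ i, u i ≤ v i) :
    ∫⁻ x, ‖∑ i ∈ s, c i * (temperedPower H lam (v i - x) - temperedPower H lam (u i - x))‖ₑ ^ 2 ≤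
      (∫⁻ y, ‖temperedPowerDeriv H lam y‖ₑ) ^ 2 *
        ∫⁻ y, ‖∑ i ∈ s, (Ioc (u i) (v i)).indicator (fun _ => c i) y‖ₑ ^ 2 := by
  have hmeas : Measurable fun y => ‖∑ i ∈ s, (Ioc (u i) (v i)).indicator (fun _ => c i) y‖ₑ :=
    (Finset.measurable_sum _ fun i _ => measurable_const.indicator measurableSet_Ioc).enorm
  refine le_trans (lintegral_mono fun x => ?_) (lintegral_sq_lintegral_mul_comp_sub_le hmeas
    (measurable_temperedPowerDeriv (H := H) (lam := lam)).enorm)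
  -- By linearity the combination is the convolution of the step function with the derivative, to
  -- which Young's inequality applies.
  have h1 : ∑ i ∈ s, c i * (temperedPower H lam (v i - x) - temperedPower H lam (u i - x)) =
      ∫ y, (∑ i ∈ s, (Ioc (u i) (v i)).indicator (fun _ => c i) y) *
        temperedPowerDeriv H lam (y - x) := by
    have hint : ∀ i, Integrable fun y => (Ioc (u i) (v i)).indicator (fun _ => c i) y *
        temperedPowerDeriv H lam (y - x) := fun i => by
      have : (fun y => (Ioc (u i) (v i)).indicator (fun _ => c i) y *
          temperedPowerDeriv H lam (y - x)) = (Ioc (u i) (v i)).indicator fun y =>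
            c i * temperedPowerDeriv H lam (y - x) := by
        ext y
        by_cases hs : y ∈ Ioc (u i) (v i)
        · rw [indicator_of_mem hs, indicator_of_mem hs]
        · rw [indicator_of_notMem hs, indicator_of_notMem hs, zero_mul]
      rw [this]
      exact (((integrable_temperedPowerDeriv hH hlam).comp_sub_right x).const_mul _).indicator
        measurableSet_Ioc
    simp only [Finset.sum_mul]
    rw [integral_finsetSum _ fun i _ => hint i]
    refine Finset.sum_congr rfl fun i _ => ?_
    rw [temperedPower_sub hH hlam (huv i), ← integral_const_mul]
    congr 1 with y
    by_cases hs : y ∈ Ioc (u i) (v i)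
    · rw [indicator_of_mem hs, indicator_of_mem hs, one_mul]
    · rw [indicator_of_notMem hs, indicator_of_notMem hs]; ring
  rw [h1]
  refine pow_le_pow_left₀ zero_le ((enorm_integral_le_lintegral_enorm _).trans_eq ?_) 2
  simp only [enorm_mul]

variable {Ω : Type*} [MeasurableSpace Ω] {d : ℕ} {μ : Measure Ω}
  {B : ℝ≥0 → Ω → EuclideanSpace ℝ (Fin d)}

lemma IsTFBM.memLp_apply (hB : IsTFBM μ H lam B) (t : ℝ≥0) (i : Fin d) :
    MemLp (fun ω => B t ω i) 2 μ :=
  (hB.gaussian.hasGaussianLaw_eval (t, i)).memLp_two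

lemma IsTFBM.memLp (hB : IsTFBM μ H lam B) (t : ℝ≥0) : MemLp (B t) 2 μ :=
  memLp_piLp_iff.2 (hB.memLp_apply t)

lemma memLp_two_tfbmKernel (hH : 1 / 2 < H) (hlam : 0 < lam) (t : ℝ) :
    MemLp (tfbmKernel H lam t) 2 volume := by
  have h : ∀ r : ℝ, MemLp (fun x => temperedPower H lam (r - x)) 2 volume := fun r =>
    (memLp_two_temperedPower hH hlam).comp_measurePreserving
      (Measure.measurePreserving_sub_left volume r)
  refine ((h t).sub (h 0)).ae_eq (ae_of_all _ fun x => ?_)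
  rw [tfbmKernel_eq]; rfl

lemma integral_sub_mul_sub {β : Type*} [MeasurableSpace β] {ν : Measure β} {a b a' b' : β → ℝ}
    (ha : MemLp a 2 ν) (hb : MemLp b 2 ν) (ha' : MemLp a' 2 ν) (hb' : MemLp b' 2 ν) :
    ∫ x, (a x - b x) * (a' x - b' x) ∂ν = ∫ x, a x * a' x ∂ν - ∫ x, a x * b' x ∂ν -
      (∫ x, b x * a' x ∂ν - ∫ x, b x * b' x ∂ν) := by
  have h1 := ha.integrable_mul ha'
  have h2 := ha.integrable_mul hb'
  have h3 := hb.integrable_mul ha'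
  have h4 := hb.integrable_mul hb'
  have h := integral_sub (h1.sub h2) (h3.sub h4)
  rw [integral_sub' h1 h2, integral_sub' h3 h4] at h
  refine Eq.trans ?_ h
  congr 1 with x
  simp only [Pi.mul_apply, Pi.sub_apply]
  ring

/-- The term of the kernel evaluated at time 0 cancels in increments, which leaves translates of
`temperedPower`. -/
lemma IsTFBM.integral_sq_sum_increment (hB : IsTFBM μ H lam B) (hH : 1 / 2 < H) (hlam : 0 < lam)
    {ι : Type*} (s : Finset ι) (c : ι → ℝ) (u v : ι → ℝ≥0) (j : Fin d) :
    ∫ ω, (∑ i ∈ s, c i * (B (v i) ω j - B (u i) ω j)) ^ 2 ∂μ =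
      ∫ x : ℝ, (∑ i ∈ s, c i * (temperedPower H lam (v i - x) - temperedPower H lam (u i - x))) ^ 2
      := by
  have hk := memLp_two_tfbmKernel hH hlam
  have h1 := integral_sq_sum_congr (ν := μ) (ρ := volume)
    (X := fun i ω => B (v i) ω j - B (u i) ω j)
    (Z := fun i x => tfbmKernel H lam (v i) x - tfbmKernel H lam (u i) x)
    (fun i => (hB.memLp_apply (v i) j).sub (hB.memLp_apply (u i) j))
    (fun i => (hk (v i)).sub (hk (u i))) (fun i k => by
      rw [integral_sub_mul_sub (hB.memLp_apply _ j) (hB.memLp_apply _ j) (hB.memLp_apply _ j)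
        (hB.memLp_apply _ j), integral_sub_mul_sub (hk _) (hk _) (hk _) (hk _)]
      simp only [hB.covariance, if_true]) s c
  rw [h1]
  simp only [tfbmKernel_eq, sub_sub_sub_cancel_right]

/-- The operator norm bound of the Wiener integral against a tempered fractional Brownian motion:
`√d` times the `L¹` norm of the derivative of the moving average kernel. -/
noncomputable def wienerConst (d : ℕ) (H lam : ℝ) : ℝ :=
  √d * ∫ y, ‖temperedPowerDeriv H lam y‖

lemma wienerConst_nonneg (d : ℕ) (H lam : ℝ) : 0 ≤ wienerConst d H lam :=
  mul_nonneg (Real.sqrt_nonneg _) (integral_nonneg fun _ => norm_nonneg _)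

/-- Every coordinate obeys the same Young bound, and adding `d` squares produces √d. The intervals
may overlap, so differences of step functions on different grids are covered. -/
lemma IsTFBM.eLpNorm_sum_increment_le (hB : IsTFBM μ H lam B) (hH : 1 / 2 < H) (hlam : 0 < lam)
    {ι : Type*} (s : Finset ι) (c : ι → ℝ) {u v : ι → ℝ≥0} (huv : ∀ i, u i ≤ v i) :
    eLpNorm (fun ω => ∑ i ∈ s, c i • (B (v i) ω - B (u i) ω)) 2 μ ≤
      ENNReal.ofReal (wienerConst d H lam) *
        eLpNorm (fun y : ℝ => ∑ i ∈ s, (Ioc (u i : ℝ) (v i)).indicator (fun _ => c i) y) 2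
          volume := by
  have hcomp : ∀ j : Fin d, ∫⁻ ω, ‖∑ i ∈ s, c i * (B (v i) ω j - B (u i) ω j)‖ₑ ^ 2 ∂μ =
      ∫⁻ x : ℝ, ‖∑ i ∈ s, c i * (temperedPower H lam (v i - x) -
        temperedPower H lam (u i - x))‖ₑ ^ 2 := by
    intro j
    have hsq : ∀ a : ℝ, ‖a‖ₑ ^ 2 = ENNReal.ofReal (a ^ 2) := fun a => by
      rw [Real.enorm_eq_ofReal_abs, ← ENNReal.ofReal_pow (abs_nonneg _), sq_abs]
    simp only [hsq]
    have hX : MemLp (fun ω => ∑ i ∈ s, c i * (B (v i) ω j - B (u i) ω j)) 2 μ :=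
      memLp_finsetSum _ fun i _ =>
        ((hB.memLp_apply (v i) j).sub (hB.memLp_apply (u i) j)).const_mul (c i)
    have hZ : MemLp (fun x : ℝ => ∑ i ∈ s, c i * (temperedPower H lam (v i - x) -
        temperedPower H lam (u i - x))) 2 volume :=
      memLp_finsetSum _ fun i _ => (MemLp.sub
        ((memLp_two_temperedPower hH hlam).comp_measurePreserving
          (Measure.measurePreserving_sub_left volume _))
        ((memLp_two_temperedPower hH hlam).comp_measurePreserving
          (Measure.measurePreserving_sub_left volume _))).const_mul (c i)
    rw [← ofReal_integral_eq_lintegral_ofReal hX.integrable_sq (ae_of_all _ fun _ => sq_nonneg _),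
      ← ofReal_integral_eq_lintegral_ofReal hZ.integrable_sq (ae_of_all _ fun _ => sq_nonneg _),
      hB.integral_sq_sum_increment hH hlam]
  have hnorm : ∀ x : EuclideanSpace ℝ (Fin d), ‖x‖ₑ ^ 2 = ∑ j, ‖x j‖ₑ ^ 2 := fun x => by
    simp only [← ofReal_norm, ← ENNReal.ofReal_pow (norm_nonneg _)]
    rw [EuclideanSpace.norm_sq_eq, ENNReal.ofReal_sum_of_nonneg fun _ _ => sq_nonneg _]
  have hmain : eLpNorm (fun ω => ∑ i ∈ s, c i • (B (v i) ω - B (u i) ω)) 2 μ ^ 2 ≤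
      (ENNReal.ofReal (wienerConst d H lam) *
        eLpNorm (fun y : ℝ => ∑ i ∈ s, (Ioc (u i : ℝ) (v i)).indicator (fun _ => c i) y) 2
          volume) ^ 2 := by
    rw [mul_pow, eLpNorm_two_sq, eLpNorm_two_sq]
    simp only [hnorm]
    rw [lintegral_finsetSum']
    · simp only [WithLp.ofLp_sum, WithLp.ofLp_smul, WithLp.ofLp_sub, Finset.sum_apply,
        Pi.smul_apply, Pi.sub_apply, smul_eq_mul, hcomp]
      rw [Finset.sum_const, Finset.card_univ, Fintype.card_fin, nsmul_eq_mul]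
      refine (mul_le_mul_right (lintegral_sq_sum_temperedPower_le hH hlam s c
        fun i => NNReal.coe_le_coe.2 (huv i)) _).trans_eq ?_
      rw [← mul_assoc, wienerConst, ENNReal.ofReal_mul (Real.sqrt_nonneg _), mul_pow,
        ← ENNReal.ofReal_pow (Real.sqrt_nonneg _), Real.sq_sqrt (Nat.cast_nonneg _),
        ENNReal.ofReal_natCast,
        ofReal_integral_norm_eq_lintegral_enorm (integrable_temperedPowerDeriv hH hlam)]
    · intro j _
      have hX : MemLp (fun ω => ∑ i ∈ s, c i • (B (v i) ω - B (u i) ω)) 2 μ :=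
        memLp_finsetSum _ fun i _ => ((hB.memLp (v i)).sub (hB.memLp (u i))).const_smul (c i)
      exact ((memLp_piLp_iff.1 hX j).aestronglyMeasurable.enorm).pow_const 2
  exact (ENNReal.pow_le_pow_left_iff two_ne_zero).1 hmain

end TemperedFBM

/-! ### The Wiener integral as a bounded operator on L² -/

section WienerIntegral

lemma stepFunction_of_mem {n : ℕ} {u : ℕ → ℝ≥0} (hu : Monotone u) (c : ℕ → ℝ) {s : ℝ}
    (h0 : (u 0 : ℝ) < s) (hn : s ≤ u n) :
    ∃ i < n, s ∈ Ioc (u i : ℝ) (u (i + 1)) ∧ stepFunction n u c s = c i := by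
  classical
  have hex : ∃ i, s ≤ u (i + 1) := ⟨n, hn.trans (NNReal.coe_le_coe.2 (hu (Nat.le_succ n)))⟩
  have hmem : s ∈ Ioc (u (Nat.find hex) : ℝ) (u (Nat.find hex + 1)) := by
    refine ⟨?_, Nat.find_spec hex⟩
    rcases Nat.eq_zero_or_pos (Nat.find hex) with h | h
    · rwa [h]
    · have := Nat.find_min hex (Nat.sub_lt h one_pos)
      rwa [show Nat.find hex - 1 + 1 = Nat.find hex from Nat.sub_add_cancel h, not_le] at this
  have hlt : Nat.find hex < n := by
    by_contra! h
    exact (hmem.1.trans_le hn).not_ge (NNReal.coe_le_coe.2 (hu h))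
  refine ⟨Nat.find hex, hlt, hmem, ?_⟩
  rw [stepFunction, Finset.sum_eq_single_of_mem _ (Finset.mem_range.2 hlt), indicator_of_mem hmem]
  intro j _ hj
  refine indicator_of_notMem (fun hs => ?_) _
  rcases lt_or_gt_of_ne hj with h | h
  · exact (hs.2.trans (NNReal.coe_le_coe.2 (hu h))).not_gt hmem.1
  · exact (hmem.2.trans (NNReal.coe_le_coe.2 (hu h))).not_gt hs.1

lemma stepFunction_of_notMem {n : ℕ} {u : ℕ → ℝ≥0} (hu : Monotone u) (c : ℕ → ℝ) {t : ℝ≥0}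
    (ht : u n ≤ t) {s : ℝ} (hs : s ∉ Ioc 0 (t : ℝ)) : stepFunction n u c s = 0 := by
  refine Finset.sum_eq_zero fun i hi => indicator_of_notMem (fun h => hs ⟨?_, ?_⟩) _
  · exact (u i).2.trans_lt h.1
  · exact h.2.trans (NNReal.coe_le_coe.2 ((hu (Finset.mem_range.1 hi)).trans ht))

lemma memLp_stepFunction (n : ℕ) (u : ℕ → ℝ≥0) (c : ℕ → ℝ) :
    MemLp (stepFunction n u c) 2 volume := by
  unfold stepFunction
  exact memLp_finsetSum _ fun i _ => memLp_indicator_const 2 measurableSet_Ioc _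
    (Or.inr measure_Ioc_lt_top.ne)

/-- Step functions are dense in `L²(0, t)`. -/
lemma exists_stepFunction_eLpNorm_sub_le {t : ℝ≥0} {f : ℝ → ℝ}
    (hf : MemLp f 2 (volume.restrict (Ioc 0 (t : ℝ)))) {ε : ℝ} (hε : 0 < ε) :
    ∃ (n : ℕ) (u : ℕ → ℝ≥0) (c : ℕ → ℝ), (Monotone u ∧ u n ≤ t) ∧
      eLpNorm (fun s => stepFunction n u c s - f s) 2 (volume.restrict (Ioc 0 (t : ℝ))) ≤
        ENNReal.ofReal ε := by
  -- Half of the error goes to a continuous approximation of `f`, the other half to sampling it on a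
  -- uniform grid finer than its modulus of continuity.
  obtain ⟨g, hg, hgm⟩ := hf.exists_boundedContinuous_eLpNorm_sub_le (by norm_num)
    (ε := ENNReal.ofReal (ε / 2)) (by simpa using hε)
  have hmtop : (volume.restrict (Ioc 0 (t : ℝ))) univ ^ ((2 : ℝ≥0∞).toReal⁻¹) ≠ ∞ :=
    ENNReal.rpow_ne_top_of_nonneg (by positivity) (by simp)
  set m := (volume.restrict (Ioc 0 (t : ℝ))) univ ^ ((2 : ℝ≥0∞).toReal⁻¹) with hm
  -- Chosen so that ε' times the square root of the length of (0,t] is at most ε/2; the summand 1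
  -- covers t = 0.
  set ε' := ε / 2 / (m.toReal + 1) with hε'
  have hmpos : 0 < m.toReal + 1 := by positivity
  have hε'pos : 0 < ε' := by positivity
  obtain ⟨δ, hδ, hgδ⟩ := Metric.uniformContinuousOn_iff.1
    (isCompact_Icc.uniformContinuousOn_of_continuous (s := Icc (0 : ℝ) t)
      g.continuous.continuousOn) ε' hε'pos
  obtain ⟨n, hn⟩ := exists_nat_gt ((t : ℝ) / δ)
  have hn0 : (0 : ℝ) < n := (div_nonneg t.2 hδ.le).trans_lt hn
  have hn0' : (n : ℝ≥0) ≠ 0 := by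
    have : n ≠ 0 := by rintro rfl; simp at hn0
    exact_mod_cast this
  let u : ℕ → ℝ≥0 := fun i => i * (t / n)
  have hu : Monotone u := fun i j hij => by
    have : (i : ℝ≥0) ≤ j := by exact_mod_cast hij
    exact mul_le_mul_left this _
  have hun : u n = t := mul_div_cancel₀ _ hn0'
  have hbound : ∀ s ∈ Ioc (0 : ℝ) t, ‖stepFunction n u (fun i => g (u (i + 1))) s - g s‖ ≤ ε' := by
    intro s hs
    obtain ⟨i, hi, hmem, hval⟩ := stepFunction_of_mem (n := n) hu (fun i => g (u (i + 1)))
      (s := s) (by simpa [u] using hs.1) (by rw [hun]; exact hs.2)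
    rw [hval]
    refine (hgδ _ ⟨NNReal.coe_nonneg _, ?_⟩ _ ⟨hs.1.le, hs.2⟩ ?_).le
    · rw [← hun]; exact NNReal.coe_le_coe.2 (hu hi)
    · rw [Real.dist_eq, abs_of_nonneg (sub_nonneg.2 hmem.2)]
      have h1 : ((u (i + 1) : ℝ≥0) : ℝ) - u i = t / n := by
        simp only [u]; push_cast; ring
      have h2 : (t : ℝ) / n < δ := by
        rw [div_lt_iff₀ hδ] at hn
        rw [div_lt_iff₀ hn0]
        linarith
      linarith [hmem.1]
  refine ⟨n, u, fun i => g (u (i + 1)), ⟨hu, hun.le⟩, ?_⟩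
  have hsm := ((memLp_stepFunction n u fun i => g (u (i + 1))).restrict (Ioc 0 (t : ℝ)))
  have h1 : eLpNorm (fun s => stepFunction n u (fun i => g (u (i + 1))) s - g s) 2
      (volume.restrict (Ioc 0 (t : ℝ))) ≤ ENNReal.ofReal (ε / 2) := by
    refine (eLpNorm_le_of_ae_bound (C := ε') ?_).trans ?_
    · exact (ae_restrict_iff' measurableSet_Ioc).2 (ae_of_all _ hbound)
    · rw [← hm, ← ENNReal.ofReal_toReal hmtop, ← ENNReal.ofReal_mul ENNReal.toReal_nonneg]
      refine ENNReal.ofReal_le_ofReal ?_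
      rw [hε', mul_div_assoc', div_le_iff₀ hmpos]
      nlinarith
  have h2 : (fun s => stepFunction n u (fun i => g (u (i + 1))) s - f s) =
      (fun s => stepFunction n u (fun i => g (u (i + 1))) s - g s) - (f - ⇑g) := by
    ext s; simp
  rw [h2, ← add_halves ε, ENNReal.ofReal_add (by positivity) (by positivity)]
  exact (eLpNorm_sub_le (hsm.1.sub hgm.1) (hf.1.sub hgm.1) (by norm_num)).trans (add_le_add h1 hg)

variable {Ω : Type*} [mΩ : MeasurableSpace Ω] {d : ℕ} {μ : Measure Ω} {H lam : ℝ}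
  {B : ℝ≥0 → Ω → EuclideanSpace ℝ (Fin d)}

lemma IsTFBM.memLp_stepIntegral (hB : IsTFBM μ H lam B) (n : ℕ) (u : ℕ → ℝ≥0) (c : ℕ → ℝ) :
    MemLp (stepIntegral B n u c) 2 μ := by
  unfold stepIntegral
  exact memLp_finsetSum _ fun i _ => ((hB.memLp _).sub (hB.memLp _)).const_smul (c i)

lemma IsTFBM.eLpNorm_stepIntegral_sub_le (hB : IsTFBM μ H lam B) (hH : 1 / 2 < H)
    (hlam : 0 < lam) {n n' : ℕ} {u u' : ℕ → ℝ≥0} (hu : Monotone u) (hu' : Monotone u')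
    (c c' : ℕ → ℝ) :
    eLpNorm (stepIntegral B n u c - stepIntegral B n' u' c') 2 μ ≤
      ENNReal.ofReal (wienerConst d H lam) *
        eLpNorm (stepFunction n u c - stepFunction n' u' c') 2 volume := by
  -- A difference of two step functions is a single signed sum over the disjoint union of the index
  -- sets, so no common refinement is needed.
  have h := hB.eLpNorm_sum_increment_le hH hlam
    ((Finset.range n).disjSum (Finset.range n')) (Sum.elim c (-c'))
    (u := Sum.elim u u') (v := Sum.elim (fun i => u (i + 1)) fun i => u' (i + 1))
    (by rintro (i | i); exacts [hu (Nat.le_succ i), hu' (Nat.le_succ i)])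
  simp only [Finset.sum_disjSum, Sum.elim_inl, Sum.elim_inr, Pi.neg_apply, neg_smul,
    Finset.sum_neg_distrib] at h
  have h1 : ∀ (s : Set ℝ) (a y : ℝ), s.indicator (fun _ => -a) y = -s.indicator (fun _ => a) y :=
    fun s a y => congrFun (indicator_neg' s fun _ => a) y
  simp only [h1, Finset.sum_neg_distrib, ← sub_eq_add_neg] at h
  exact h

/-- The step function as an element of `L²(ℝ)`. -/
noncomputable def stepLp (n : ℕ) (u : ℕ → ℝ≥0) (c : ℕ → ℝ) : Lp ℝ 2 (volume : Measure ℝ) :=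
  (memLp_stepFunction n u c).toLp _

/-- The integral of a step function as an element of `L²(Ω; ℝᵈ)`. -/
noncomputable def IsTFBM.stepInt (hB : IsTFBM μ H lam B) (n : ℕ) (u : ℕ → ℝ≥0) (c : ℕ → ℝ) :
    L2 d μ :=
  (hB.memLp_stepIntegral n u c).toLp _

lemma stepLp_zero (u : ℕ → ℝ≥0) (c : ℕ → ℝ) : stepLp 0 u c = 0 := by
  rw [Lp.eq_zero_iff_ae_eq_zero, stepLp]
  refine (memLp_stepFunction 0 u c).coeFn_toLp.trans (ae_of_all _ fun s => ?_)
  simp [stepFunction]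

lemma IsTFBM.stepInt_zero (hB : IsTFBM μ H lam B) (u : ℕ → ℝ≥0) (c : ℕ → ℝ) :
    hB.stepInt 0 u c = 0 := by
  rw [Lp.eq_zero_iff_ae_eq_zero, stepInt]
  refine (hB.memLp_stepIntegral 0 u c).coeFn_toLp.trans (ae_of_all _ fun ω => ?_)
  simp [stepIntegral]

lemma IsTFBM.dist_stepInt_le (hB : IsTFBM μ H lam B) (hH : 1 / 2 < H)
    (hlam : 0 < lam) {n n' : ℕ} {u u' : ℕ → ℝ≥0} (hu : Monotone u) (hu' : Monotone u')
    (c c' : ℕ → ℝ) :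
    dist (hB.stepInt n u c) (hB.stepInt n' u' c') ≤
      wienerConst d H lam * dist (stepLp n u c) (stepLp n' u' c') := by
  have h := hB.eLpNorm_stepIntegral_sub_le hH hlam (n := n) (n' := n') hu hu' c c'
  rw [← Lp.edist_toLp_toLp _ _ (hB.memLp_stepIntegral n u c) (hB.memLp_stepIntegral n' u' c'),
    ← Lp.edist_toLp_toLp _ _ (memLp_stepFunction n u c) (memLp_stepFunction n' u' c'),
    edist_dist, edist_dist, ← ENNReal.ofReal_mul (wienerConst_nonneg _ _ _)] at h
  exact (ENNReal.ofReal_le_ofReal_iff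
    (mul_nonneg (wienerConst_nonneg _ _ _) dist_nonneg)).1 h

lemma tendsto_stepLp_iff {t : ℝ≥0} {f : ℝ → ℝ}
    (hf : MemLp ((Ioc 0 (t : ℝ)).indicator f) 2 volume) {n : ℕ → ℕ} {u : ℕ → ℕ → ℝ≥0}
    {c : ℕ → ℕ → ℝ} (hu : ∀ k, Monotone (u k) ∧ u k (n k) ≤ t) :
    Tendsto (fun k => eLpNorm (fun s => stepFunction (n k) (u k) (c k) s - f s) 2
      (volume.restrict (Ioc 0 (t : ℝ)))) atTop (𝓝 0) ↔
    Tendsto (fun k => stepLp (n k) (u k) (c k)) atTop (𝓝 (hf.toLp _)) := by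
  simp only [stepLp]
  rw [Lp.tendsto_Lp_iff_tendsto_eLpNorm'' _ (fun k => memLp_stepFunction _ _ _) _ hf]
  refine tendsto_congr fun k => ?_
  rw [← eLpNorm_indicator_eq_eLpNorm_restrict measurableSet_Ioc]
  congr 1
  ext s
  by_cases hs : s ∈ Ioc (0 : ℝ) t
  · simp [indicator_of_mem hs]
  · simp [indicator_of_notMem hs, stepFunction_of_notMem (hu k).1 (c k) (hu k).2 hs]

/-- The Wiener integral, expressed by convergence in `L²(ℝ)` and `L²(Ω; ℝᵈ)`. -/
lemma IsTFBM.isWienerIntegral_iff (hB : IsTFBM μ H lam B) {t : ℝ≥0} {f : ℝ → ℝ}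
    (hf : MemLp ((Ioc 0 (t : ℝ)).indicator f) 2 volume) {Y : L2 d μ} :
    IsWienerIntegral μ B t f Y ↔ ∃ (n : ℕ → ℕ) (u : ℕ → ℕ → ℝ≥0) (c : ℕ → ℕ → ℝ),
      (∀ k, Monotone (u k) ∧ u k (n k) ≤ t) ∧
      Tendsto (fun k => stepLp (n k) (u k) (c k)) atTop (𝓝 (hf.toLp _)) ∧
      Tendsto (fun k => hB.stepInt (n k) (u k) (c k)) atTop (𝓝 Y) := by
  refine exists_congr fun n => exists_congr fun u => exists_congr fun c =>
    and_congr_right fun hu => and_congr (tendsto_stepLp_iff hf hu) ?_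
  rw [Lp.tendsto_Lp_iff_tendsto_eLpNorm']
  refine tendsto_congr fun k => ?_
  have h : ⇑(hB.stepInt (n k) (u k) (c k)) =ᵐ[μ] stepIntegral B (n k) (u k) (c k) :=
    (hB.memLp_stepIntegral (n k) (u k) (c k)).coeFn_toLp
  exact eLpNorm_congr_ae (h.symm.sub (EventuallyEq.refl _ _))

/-- The bound for step functions passes to the limit. Extension by zero lets different time horizons
be compared, which yields continuity of the stochastic convolution in time. -/
lemma IsTFBM.dist_wienerIntegral_le (hB : IsTFBM μ H lam B) (hH : 1 / 2 < H) (hlam : 0 < lam)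
    {t t' : ℝ≥0} {f f' : ℝ → ℝ} (hf : MemLp ((Ioc 0 (t : ℝ)).indicator f) 2 volume)
    (hf' : MemLp ((Ioc 0 (t' : ℝ)).indicator f') 2 volume) {Y Y' : L2 d μ}
    (hY : IsWienerIntegral μ B t f Y) (hY' : IsWienerIntegral μ B t' f' Y') :
    dist Y Y' ≤ wienerConst d H lam * dist (hf.toLp _) (hf'.toLp _) := by
  obtain ⟨n, u, c, hu, h1, h2⟩ := (hB.isWienerIntegral_iff hf).1 hY
  obtain ⟨n', u', c', hu', h1', h2'⟩ := (hB.isWienerIntegral_iff hf').1 hY'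
  exact le_of_tendsto_of_tendsto' (h2.dist h2') ((h1.dist h1').const_mul _) fun k =>
    hB.dist_stepInt_le hH hlam (hu k).1 (hu' k).1 _ _

lemma IsTFBM.norm_wienerIntegral_le (hB : IsTFBM μ H lam B) (hH : 1 / 2 < H) (hlam : 0 < lam)
    {t : ℝ≥0} {f : ℝ → ℝ} (hf : MemLp ((Ioc 0 (t : ℝ)).indicator f) 2 volume) {Y : L2 d μ}
    (hY : IsWienerIntegral μ B t f Y) : ‖Y‖ ≤ wienerConst d H lam * ‖hf.toLp _‖ := by
  obtain ⟨n, u, c, hu, h1, h2⟩ := (hB.isWienerIntegral_iff hf).1 hY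
  refine le_of_tendsto_of_tendsto' h2.norm (h1.norm.const_mul _) fun k => ?_
  -- Comparison with the empty step function, whose integral is zero.
  have h := hB.dist_stepInt_le hH hlam (hu k).1 (hu k).1 (n := n k) (n' := 0) (c k) (c k)
  rwa [hB.stepInt_zero, stepLp_zero, dist_zero_right, dist_zero_right] at h

lemma IsTFBM.exists_isWienerIntegral (hB : IsTFBM μ H lam B) (hH : 1 / 2 < H) (hlam : 0 < lam)
    {t : ℝ≥0} {f : ℝ → ℝ} (hf : MemLp ((Ioc 0 (t : ℝ)).indicator f) 2 volume) :
    ∃ Y : L2 d μ, IsWienerIntegral μ B t f Y := by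
  have hf' : MemLp f 2 (volume.restrict (Ioc 0 (t : ℝ))) :=
    (memLp_indicator_iff_restrict measurableSet_Ioc).1 hf
  choose n u c hu h using fun k : ℕ => exists_stepFunction_eLpNorm_sub_le hf'
    (ε := 1 / ((k : ℝ) + 1)) (by positivity)
  have hlim : Tendsto (fun k => eLpNorm (fun s => stepFunction (n k) (u k) (c k) s - f s) 2
      (volume.restrict (Ioc 0 (t : ℝ)))) atTop (𝓝 0) := by
    refine tendsto_of_tendsto_of_tendsto_of_le_of_le tendsto_const_nhds ?_ (fun _ => zero_le) h
    rw [← ENNReal.ofReal_zero]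
    exact ENNReal.tendsto_ofReal tendsto_one_div_add_atTop_nhds_zero_nat
  have hlim' : Tendsto (fun k => stepLp (n k) (u k) (c k)) atTop (𝓝 (hf.toLp _)) := (tendsto_stepLp_iff hf hu).1 hlim
  have hcauchy : CauchySeq fun k => hB.stepInt (n k) (u k) (c k) := by
    rw [Metric.cauchySeq_iff]
    intro ε hε
    have hC := wienerConst_nonneg d H lam
    obtain ⟨N, hN⟩ := Metric.cauchySeq_iff.1 hlim'.cauchySeq (ε / (wienerConst d H lam + 1))
      (by positivity)
    refine ⟨N, fun k hk l hl => ?_⟩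
    have h1 := hB.dist_stepInt_le hH hlam (hu k).1 (hu l).1 (n := n k) (n' := n l) (c k) (c l)
    have h2 := hN k hk l hl
    rw [lt_div_iff₀ (by positivity)] at h2
    have h3 : 0 ≤ dist (stepLp (n k) (u k) (c k)) (stepLp (n l) (u l) (c l)) := dist_nonneg
    nlinarith
  obtain ⟨Y, hY⟩ := cauchySeq_tendsto_of_complete hcauchy
  exact ⟨Y, (hB.isWienerIntegral_iff hf).2 ⟨n, u, c, hu, hlim', hY⟩⟩

/-- The Wiener integral over `(0, t]` is `𝓕 t`-measurable. -/
lemma IsTFBM.aestronglyMeasurable_wienerIntegral (hB : IsTFBM μ H lam B)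
    {𝓕 : Filtration ℝ≥0 mΩ} (had : StronglyAdapted 𝓕 B) {t : ℝ≥0} {f : ℝ → ℝ}
    (hf : MemLp ((Ioc 0 (t : ℝ)).indicator f) 2 volume) {Y : L2 d μ}
    (hY : IsWienerIntegral μ B t f Y) : AEStronglyMeasurable[𝓕 t] Y μ := by
  obtain ⟨n, u, c, hu, -, h2⟩ := (hB.isWienerIntegral_iff hf).1 hY
  -- Each step integral involves only times up to t, and 𝓕 t-measurability is closed under L²
  -- limits.
  refine (isClosed_aestronglyMeasurable (F := EuclideanSpace ℝ (Fin d)) (p := 2) (μ := μ)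
    (𝓕.le t)).mem_of_tendsto h2 (Eventually.of_forall fun k => ?_)
  have hsm : StronglyMeasurable[𝓕 t] (stepIntegral B (n k) (u k) (c k)) := by
    unfold stepIntegral
    refine Finset.stronglyMeasurable_fun_sum _ fun i hi => ?_
    have hle : u k (i + 1) ≤ t := ((hu k).1 (Finset.mem_range.1 hi)).trans (hu k).2
    exact (((had _).mono (𝓕.mono hle)).sub
      ((had _).mono (𝓕.mono (((hu k).1 (Nat.le_succ i)).trans hle)))).const_smul (c k i)
  exact hsm.aestronglyMeasurable.congr (hB.memLp_stepIntegral _ _ _).coeFn_toLp.symm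

end WienerIntegral

/-! ### The drift as a map on L²(Ω) -/

section Superposition

lemma lintegral_enorm_sq_eq_ofReal_norm_sq {Ω : Type*} [MeasurableSpace Ω] {μ : Measure Ω} {d : ℕ}
    (x : L2 d μ) : ∫⁻ ω, ‖x ω‖ₑ ^ 2 ∂μ = ENNReal.ofReal (‖x‖ ^ 2) := by
  rw [← eLpNorm_two_sq, ENNReal.ofReal_pow (norm_nonneg _), ofReal_norm, Lp.enorm_def]

/-- The Lipschitz condition in mean square on the vector field. -/
def IsMeanLipschitz {Ω : Type*} [MeasurableSpace Ω] {d : ℕ} (μ : Measure Ω) {P : Type*}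
    [MetricSpace P] (L : ℝ) (g : EuclideanSpace ℝ (Fin d) → P → EuclideanSpace ℝ (Fin d)) : Prop :=
  ∀ (x y : L2 d μ) (p q : P),
    ∫⁻ ω, ‖g (x ω) p - g (y ω) q‖ₑ ^ 2 ∂μ ≤
      ENNReal.ofReal L * ∫⁻ ω, ‖x ω - y ω‖ₑ ^ 2 ∂μ + ENNReal.ofReal (L * dist p q ^ 2)

variable {Ω : Type*} [mΩ : MeasurableSpace Ω] {d : ℕ} {μ : Measure Ω} {P : Type*} [MetricSpace P]
  {L : ℝ} {g : EuclideanSpace ℝ (Fin d) → P → EuclideanSpace ℝ (Fin d)}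

lemma le_sqrt_mul_add_of_sq_le {a b c L : ℝ} (hL : 0 ≤ L) (hb : 0 ≤ b) (hc : 0 ≤ c)
    (h : a ^ 2 ≤ L * b ^ 2 + L * c ^ 2) : a ≤ √L * (b + c) := by
  refine le_of_sq_le_sq ?_ (by positivity)
  rw [mul_pow, Real.sq_sqrt hL]
  nlinarith [mul_nonneg hL (mul_nonneg hb hc)]

/-- On constant random vectors the mean square condition becomes a pointwise Lipschitz bound,
because μ has mass one. It makes `g` continuous in space, hence compositions with random vectors
measurable. -/
lemma IsMeanLipschitz.norm_sub_le [IsProbabilityMeasure μ] (hg : IsMeanLipschitz μ L g)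
    (hL : 0 ≤ L) (a b : EuclideanSpace ℝ (Fin d)) (p q : P) :
    ‖g a p - g b q‖ ≤ √L * (‖a - b‖ + dist p q) := by
  have ha := (memLp_const (μ := μ) (p := 2) a).coeFn_toLp
  have hb := (memLp_const (μ := μ) (p := 2) b).coeFn_toLp
  have h := hg ((memLp_const a).toLp _) ((memLp_const b).toLp _) p q
  have h1 : ∀ᵐ ω ∂μ, ‖g ((memLp_const (μ := μ) (p := 2) a).toLp _ ω) p -
      g ((memLp_const (μ := μ) (p := 2) b).toLp _ ω) q‖ₑ ^ 2 = ‖g a p - g b q‖ₑ ^ 2 := by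
    filter_upwards [ha, hb] with ω h1 h2
    rw [h1, h2]
  have h2 : ∀ᵐ ω ∂μ, ‖(memLp_const (μ := μ) (p := 2) a).toLp _ ω -
      (memLp_const (μ := μ) (p := 2) b).toLp _ ω‖ₑ ^ 2 = ‖a - b‖ₑ ^ 2 := by
    filter_upwards [ha, hb] with ω h1 h2
    rw [h1, h2]
  rw [lintegral_congr_ae h1, lintegral_congr_ae h2, lintegral_const, lintegral_const,
    measure_univ, mul_one, mul_one, ← ofReal_norm, ← ofReal_norm,
    ← ENNReal.ofReal_pow (norm_nonneg _), ← ENNReal.ofReal_pow (norm_nonneg _),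
    ← ENNReal.ofReal_mul hL, ← ENNReal.ofReal_add (by positivity) (by positivity),
    ENNReal.ofReal_le_ofReal_iff (by positivity)] at h
  exact le_sqrt_mul_add_of_sq_le hL (norm_nonneg _) dist_nonneg h

lemma IsMeanLipschitz.continuous [IsProbabilityMeasure μ] (hg : IsMeanLipschitz μ L g)
    (hL : 0 ≤ L) (p : P) : Continuous fun a => g a p := by
  refine (LipschitzWith.of_dist_le_mul (K := (√L).toNNReal) fun a b => ?_).continuous
  rw [Real.coe_toNNReal _ (Real.sqrt_nonneg _)]
  simpa [dist_eq_norm] using hg.norm_sub_le hL a b p p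

lemma IsMeanLipschitz.memLp_comp [IsProbabilityMeasure μ] (hg : IsMeanLipschitz μ L g)
    (hL : 0 ≤ L) (p : P) (x : L2 d μ) : MemLp (fun ω => g (x ω) p) 2 μ := by
  refine MemLp.mono' (g := fun ω => √L * ‖x ω‖ + ‖g 0 p‖)
    (((Lp.memLp x).norm.const_mul _).add (memLp_const _))
    ((hg.continuous hL p).comp_aestronglyMeasurable (Lp.aestronglyMeasurable x))
    (ae_of_all _ fun ω => ?_)
  have h := hg.norm_sub_le hL (x ω) 0 p p
  rw [dist_self, add_zero, sub_zero] at h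
  linarith [norm_le_norm_sub_add (g (x ω) p) (g 0 p)]

lemma IsMeanLipschitz.superposition_ae_eq [IsProbabilityMeasure μ] (hg : IsMeanLipschitz μ L g)
    (hL : 0 ≤ L) (p : P) (x : L2 d μ) : superposition g p x =ᵐ[μ] fun ω => g (x ω) p := by
  rw [superposition, dif_pos (hg.memLp_comp hL p x)]
  exact (hg.memLp_comp hL p x).coeFn_toLp

lemma IsMeanLipschitz.norm_superposition_sub_le [IsProbabilityMeasure μ]
    (hg : IsMeanLipschitz μ L g) (hL : 0 ≤ L) (p q : P) (x y : L2 d μ) :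
    ‖superposition g p x - superposition g q y‖ ≤ √L * (‖x - y‖ + dist p q) := by
  refine le_sqrt_mul_add_of_sq_le hL (norm_nonneg _) dist_nonneg ?_
  have h := hg x y p q
  have h1 : ∫⁻ ω, ‖g (x ω) p - g (y ω) q‖ₑ ^ 2 ∂μ =
      ENNReal.ofReal (‖superposition g p x - superposition g q y‖ ^ 2) := by
    rw [← lintegral_enorm_sq_eq_ofReal_norm_sq]
    refine lintegral_congr_ae ?_
    filter_upwards [Lp.coeFn_sub (superposition g p x) (superposition g q y),
      hg.superposition_ae_eq hL p x, hg.superposition_ae_eq hL q y] with ω h1 h2 h3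
    rw [h1, Pi.sub_apply, h2, h3]
  have h2 : ∫⁻ ω, ‖x ω - y ω‖ₑ ^ 2 ∂μ = ENNReal.ofReal (‖x - y‖ ^ 2) := by
    rw [← lintegral_enorm_sq_eq_ofReal_norm_sq]
    refine lintegral_congr_ae ?_
    filter_upwards [Lp.coeFn_sub x y] with ω h1
    rw [h1, Pi.sub_apply]
  rw [h1, h2, ← ENNReal.ofReal_mul hL, ← ENNReal.ofReal_add (by positivity) (by positivity),
    ENNReal.ofReal_le_ofReal_iff (by positivity)] at h
  exact h

lemma IsMeanLipschitz.continuous_superposition [IsProbabilityMeasure μ]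
    (hg : IsMeanLipschitz μ L g) (hL : 0 ≤ L) :
    Continuous fun q : P × L2 d μ => superposition g q.1 q.2 := by
  refine (LipschitzWith.of_dist_le_mul (K := (√L * 2).toNNReal) fun a b => ?_).continuous
  rw [dist_eq_norm]
  refine (hg.norm_superposition_sub_le hL a.1 b.1 a.2 b.2).trans ?_
  have h1 : dist a.1 b.1 ≤ dist a b := le_max_left _ _
  have h2 : ‖a.2 - b.2‖ ≤ dist a b := by rw [← dist_eq_norm]; exact le_max_right _ _
  rw [Real.coe_toNNReal _ (by positivity), mul_assoc]
  gcongr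
  linarith

/-- Compactness gives P finite diameter, so the value at one reference point controls all
parameters. -/
lemma IsMeanLipschitz.exists_norm_superposition_le [IsProbabilityMeasure μ] [CompactSpace P]
    (hg : IsMeanLipschitz μ L g) (hL : 0 ≤ L) (o : P) :
    ∃ G, 0 ≤ G ∧ ∀ (p : P) (x : L2 d μ), ‖superposition g p x‖ ≤ G + √L * ‖x‖ := by
  refine ⟨√L * Metric.diam (univ : Set P) + ‖superposition g o (0 : L2 d μ)‖, by positivity,
    fun p x => ?_⟩
  have h := hg.norm_superposition_sub_le hL p o x 0
  have h1 : dist p o ≤ Metric.diam (univ : Set P) :=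
    Metric.dist_le_diam_of_mem isCompact_univ.isBounded (mem_univ _) (mem_univ _)
  have h2 : √L * dist p o ≤ √L * Metric.diam (univ : Set P) := by gcongr
  rw [sub_zero, mul_add] at h
  linarith [norm_le_norm_sub_add (superposition g p x) (superposition g o (0 : L2 d μ))]

end Superposition

lemma IsMeanLipschitz.aestronglyMeasurable_superposition {Ω P : Type*} {m mΩ : MeasurableSpace Ω}
    {d : ℕ} {μ : Measure Ω} [IsProbabilityMeasure μ] [MetricSpace P] {L : ℝ}
    {g : EuclideanSpace ℝ (Fin d) → P → EuclideanSpace ℝ (Fin d)} (hg : IsMeanLipschitz μ L g)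
    (hL : 0 ≤ L) (p : P) {x : L2 d μ} (hx : AEStronglyMeasurable[m] x μ) : AEStronglyMeasurable[m] (superposition g p x) μ :=
  ((hg.continuous hL p).comp_aestronglyMeasurable hx).congr (hg.superposition_ae_eq hL p x).symm

/-! ### Dissipativity of solutions -/

section APriori

/-- Gronwall's inequality for the memory kernel: a continuous function that satisfies the Volterra
inequality enters a ball whose radius does not depend on the initial value. -/
lemma le_add_exp_of_volterra {α ϱ ℓ K A C : ℝ} (hα : 0 < α) (hϱ : 0 < ϱ) (hℓ : 0 ≤ ℓ)
    (hK0 : 0 ≤ K) (hA : 0 ≤ A) (hsmall : ℓ * (ϱ / 2) ^ (-α) ≤ 1 / 2) {G : ℝ} (hG : 0 ≤ G)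
    (hK : (G + ℓ * K) * ϱ ^ (-α) + C ≤ K) {w : ℝ≥0 → ℝ} (hw : Continuous w)
    (hvol : ∀ t : ℝ≥0, ∀ f : ℝ → ℝ,
      IntervalIntegrable (fun s => memoryKernel α ϱ t s * f s) volume 0 t →
      (∀ s : ℝ, 0 ≤ s → s ≤ t → G + ℓ * w s.toNNReal ≤ f s) →
      w t ≤ Real.exp (-ϱ * t) * A + (∫ s in (0 : ℝ)..t, memoryKernel α ϱ t s * f s) + C)
    (T : ℝ≥0) : w T ≤ K + 2 * A * Real.exp (-(ϱ / 2) * T) := by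
  -- The excess over `K`, weighted by e^{ϱs/2}, is maximized on [0,T]; the Volterra inequality at
  -- the maximum point bounds it.
  obtain ⟨t, ⟨-, htT⟩, ht⟩ := (isCompact_Icc (a := (0 : ℝ≥0)) (b := T)).exists_isMaxOn
    ⟨0, left_mem_Icc.2 (zero_le)⟩
    (f := fun s : ℝ≥0 => (w s - K) * Real.exp (ϱ / 2 * s)) (by fun_prop)
  set m := max ((w t - K) * Real.exp (ϱ / 2 * t)) 0 with hm
  have hm0 : 0 ≤ m := le_max_right _ _
  have hbound : ∀ s : ℝ≥0, s ≤ T → w s ≤ K + m * Real.exp (-(ϱ / 2) * s) := by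
    intro s hs
    have h1 : (w s - K) * Real.exp (ϱ / 2 * s) ≤ m := (ht ⟨zero_le, hs⟩).trans (le_max_left _ _)
    have h2 : (w s - K) * Real.exp (ϱ / 2 * s) * Real.exp (-(ϱ / 2) * s) ≤
        m * Real.exp (-(ϱ / 2) * s) := by gcongr
    rw [mul_assoc, ← Real.exp_add] at h2
    simp only [neg_mul, add_neg_cancel, Real.exp_zero, mul_one] at h2 ⊢
    linarith
  have hm2 : m ≤ 2 * A := by
    -- Half of the damping absorbs the weight; the other half stays in a kernel of rate ϱ/2, whose
    -- mass is at most (ϱ/2)^{-α}.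
    have hk : ∀ s, memoryKernel α ϱ t s * (G + ℓ * K + ℓ * m * Real.exp (-(ϱ / 2) * s)) =
        (G + ℓ * K) * memoryKernel α ϱ t s +
          ℓ * m * Real.exp (-(ϱ / 2) * t) * memoryKernel α (ϱ / 2) t s := by
      intro s
      have : Real.exp (-ϱ * (t - s)) * Real.exp (-(ϱ / 2) * s) =
          Real.exp (-(ϱ / 2) * t) * Real.exp (-(ϱ / 2) * (t - s)) := by
        rw [← Real.exp_add, ← Real.exp_add]; ring_nf
      simp only [memoryKernel]
      linear_combination (1 / Real.Gamma α * (t - s) ^ (α - 1) * ℓ * m) * this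
    have hi1 := (intervalIntegrable_memoryKernel hα hϱ t.coe_nonneg).const_mul (G + ℓ * K)
    have hi2 := (intervalIntegrable_memoryKernel hα (half_pos hϱ) t.coe_nonneg).const_mul
      (ℓ * m * Real.exp (-(ϱ / 2) * t))
    -- The bound on `w` from the maximum provides an explicit majorant whose integral can be
    -- estimated.
    have h := hvol t (fun s => G + ℓ * K + ℓ * m * Real.exp (-(ϱ / 2) * s))
      (by simp only [hk]; exact hi1.add hi2) (fun s hs0 hst => by
        have hst' : s.toNNReal ≤ t := by
          rw [← NNReal.coe_le_coe, Real.coe_toNNReal s hs0]; exact hst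
        have h1 := hbound s.toNNReal (hst'.trans htT)
        rw [Real.coe_toNNReal s hs0] at h1
        have h2 : ℓ * w s.toNNReal ≤ ℓ * (K + m * Real.exp (-(ϱ / 2) * s)) := by gcongr
        linarith)
    simp only [hk] at h
    rw [intervalIntegral.integral_add hi1 hi2, intervalIntegral.integral_const_mul,
      intervalIntegral.integral_const_mul] at h
    have h1 : (G + ℓ * K) * ∫ s in (0 : ℝ)..t, memoryKernel α ϱ t s ≤ (G + ℓ * K) * ϱ ^ (-α) := by
      gcongr
      exact integral_memoryKernel_le hα hϱ t.coe_nonneg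
    have h2 : ℓ * m * Real.exp (-(ϱ / 2) * t) *
        ∫ s in (0 : ℝ)..t, memoryKernel α (ϱ / 2) t s ≤ m / 2 * Real.exp (-(ϱ / 2) * t) := by
      calc _ ≤ ℓ * m * Real.exp (-(ϱ / 2) * t) * (ϱ / 2) ^ (-α) := by
            gcongr
            exact integral_memoryKernel_le hα (half_pos hϱ) t.coe_nonneg
        _ = ℓ * (ϱ / 2) ^ (-α) * (m * Real.exp (-(ϱ / 2) * t)) := by ring
        _ ≤ 1 / 2 * (m * Real.exp (-(ϱ / 2) * t)) := by gcongr
        _ = _ := by ring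
    have h3 : Real.exp (-ϱ * t) * A ≤ Real.exp (-(ϱ / 2) * t) * A := by
      refine mul_le_mul_of_nonneg_right (Real.exp_le_exp.2 ?_) hA
      nlinarith [t.coe_nonneg, hϱ]
    have h4 : w t - K ≤ (A + m / 2) * Real.exp (-(ϱ / 2) * t) := by linarith
    have h5 : (w t - K) * Real.exp (ϱ / 2 * t) ≤ A + m / 2 := by
      have := mul_le_mul_of_nonneg_right h4 (Real.exp_pos (ϱ / 2 * t)).le
      rw [mul_assoc (A + m / 2), ← Real.exp_add] at this
      simpa using this
    -- If the maximum is positive it equals m, and m ≤ A + m/2; otherwise m = 0.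
    rcases max_cases ((w t - K) * Real.exp (ϱ / 2 * t)) 0 with ⟨h6, -⟩ | ⟨h6, -⟩
    · rw [← hm] at h6; linarith
    · rw [← hm] at h6; linarith
  refine (hbound T le_rfl).trans ?_
  gcongr

variable {Ω : Type*} [mΩ : MeasurableSpace Ω] {d : ℕ} {μ : Measure Ω} {P : Type*} [MetricSpace P]
  {L α ϱ H lam : ℝ} {g : EuclideanSpace ℝ (Fin d) → P → EuclideanSpace ℝ (Fin d)}
  {B : ℝ≥0 → Ω → EuclideanSpace ℝ (Fin d)}

/-- The uniform bound on the stochastic convolution. -/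
noncomputable def noiseBound (d : ℕ) (H lam α ϱ : ℝ) : ℝ :=
  wienerConst d H lam * (eLpNorm (memoryDensity α ϱ) 2 volume).toReal

lemma noiseBound_nonneg (d : ℕ) (H lam α ϱ : ℝ) : 0 ≤ noiseBound d H lam α ϱ :=
  mul_nonneg (wienerConst_nonneg _ _ _) ENNReal.toReal_nonneg

lemma IsTFBM.norm_wienerIntegral_memoryKernel_le (hB : IsTFBM μ H lam B) (hH : 1 / 2 < H)
    (hlam : 0 < lam) (hα : 1 / 2 < α) (hϱ : 0 < ϱ) {t : ℝ≥0} {Y : L2 d μ}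
    (hY : IsWienerIntegral μ B t (memoryKernel α ϱ t) Y) : ‖Y‖ ≤ noiseBound d H lam α ϱ := by
  have hm : MemLp ((Ioc 0 (t : ℝ)).indicator (memoryKernel α ϱ t)) 2 volume :=
    memLp_two_cutKernel hα hϱ t
  refine (hB.norm_wienerIntegral_le hH hlam hm hY).trans ?_
  rw [Lp.norm_toLp]
  exact mul_le_mul_of_nonneg_left (ENNReal.toReal_mono (memLp_two_memoryDensity hα hϱ).2.ne
    (eLpNorm_cutKernel_le 2 t)) (wienerConst_nonneg _ _ _)

lemma IsMeanLipschitz.exists_isDissipative [IsProbabilityMeasure μ] [CompactSpace P]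
    (hg : IsMeanLipschitz μ L g) (hL : 0 ≤ L) (o : P) (hB : IsTFBM μ H lam B) (hH : 1 / 2 < H)
    (hlam : 0 < lam) (hα : 1 / 2 < α) (hϱ : 0 < ϱ) (hsmall : √L * (ϱ / 2) ^ (-α) ≤ 1 / 2)
    (𝓕 : Filtration ℝ≥0 mΩ) (ϑ : ℝ → P → P) :
    ∃ K, IsDissipative (IsSolution μ 𝓕 B α ϱ g ϑ) K (ϱ / 2) := by
  obtain ⟨G, hG, hGle⟩ := hg.exists_norm_superposition_le hL o
  set C := noiseBound d H lam α ϱ with hC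
  have hC0 : 0 ≤ C := noiseBound_nonneg ..
  have hα0 : 0 < α := by linarith
  have hϱα : 0 ≤ ϱ ^ (-α) := by positivity
  have hsmall' : √L * ϱ ^ (-α) ≤ 1 / 2 := by
    refine le_trans (mul_le_mul_of_nonneg_left ?_ (Real.sqrt_nonneg _)) hsmall
    exact Real.rpow_le_rpow_of_nonpos (by linarith) (by linarith) (by linarith)
  -- Since √L ϱ^{-α} ≤ 1/2, this radius satisfies (G + √L K)ϱ^{-α} + C ≤ K.
  refine ⟨2 * (G * ϱ ^ (-α) + C), fun x₀ p x hx => ?_⟩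
  refine le_add_exp_of_volterra (ℓ := √L) (G := G) (C := C) hα0 hϱ (Real.sqrt_nonneg _)
    (by positivity) (norm_nonneg x₀) hsmall hG ?_ hx.continuous.norm fun t f hf hfle => ?_
  · nlinarith [mul_le_mul_of_nonneg_right hsmall'
      (by positivity : 0 ≤ 2 * (G * ϱ ^ (-α) + C))]
  · obtain ⟨Y, hY, heq⟩ := hx.equation t
    have hYle := hB.norm_wienerIntegral_memoryKernel_le hH hlam hα hϱ hY
    rw [heq]
    refine (norm_add₃_le).trans (add_le_add (add_le_add ?_ ?_) hYle)
    · rw [norm_smul, Real.norm_eq_abs, abs_of_pos (Real.exp_pos _)]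
    · refine intervalIntegral.norm_integral_le_of_norm_le t.coe_nonneg (ae_of_all _ fun s hs => ?_) hf
      have h1 := memoryKernel_nonneg (α := α) (ϱ := ϱ) hα0 hs.2
      rw [norm_smul, Real.norm_eq_abs, abs_of_nonneg h1]
      exact mul_le_mul_of_nonneg_left ((hGle _ _).trans (hfle s hs.1.le hs.2)) h1

end APriori

/-! ### Convolution of the kernel with a bounded curve -/

section VolterraIntegral

/-- The integral is orthogonal to everything orthogonal to `S`, and a closed subspace is its own
double complement. It serves to show that the drift integral is adapted. -/
lemma Submodule.integral_mem_of_forall_mem {β E : Type*} [MeasurableSpace β] {ν : Measure β}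
    [NormedAddCommGroup E] [InnerProductSpace ℝ E] [CompleteSpace E] (S : Submodule ℝ E)
    (hS : IsClosed (S : Set E)) {f : β → E} (hf : Integrable f ν) (h : ∀ b, f b ∈ S) :
    ∫ b, f b ∂ν ∈ S := by
  have : CompleteSpace S := hS.completeSpace_coe
  rw [← Submodule.orthogonal_orthogonal S, Submodule.mem_orthogonal]
  intro v hv
  rw [← integral_inner hf v]
  refine integral_eq_zero_of_ae (ae_of_all _ fun b => ?_)
  exact (Submodule.mem_orthogonal' S v).1 hv _ (h b)

variable {E : Type*} [NormedAddCommGroup E] [NormedSpace ℝ E] {α ϱ b : ℝ} {F : ℝ → E}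

lemma integrable_cutKernel (hα : 0 < α) (hϱ : 0 < ϱ) (t : ℝ) : Integrable (cutKernel α ϱ t) :=
  (integrable_indicator_iff measurableSet_Ioc).2 (integrableOn_memoryKernel hα hϱ t)

lemma cutKernel_nonneg (hα : 0 < α) (t s : ℝ) : 0 ≤ cutKernel α ϱ t s :=
  indicator_nonneg (fun _ hs => memoryKernel_nonneg hα hs.2) s

lemma integral_cutKernel_le (hα : 0 < α) (hϱ : 0 < ϱ) {t : ℝ} (ht : 0 ≤ t) :
    ∫ s, cutKernel α ϱ t s ≤ ϱ ^ (-α) := by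
  unfold cutKernel
  rw [integral_indicator measurableSet_Ioc, ← intervalIntegral.integral_of_le ht]
  exact integral_memoryKernel_le hα hϱ ht

lemma cutKernel_smul (F : ℝ → E) (t s : ℝ) :
    cutKernel α ϱ t s • F s = (Ioc 0 t).indicator (fun s => memoryKernel α ϱ t s • F s) s := by
  rw [cutKernel, indicator_smul_left]

lemma integrable_cutKernel_smul (hα : 0 < α) (hϱ : 0 < ϱ) (hF : StronglyMeasurable F)
    (hb : ∀ s, ‖F s‖ ≤ b) (t : ℝ) : Integrable fun s => cutKernel α ϱ t s • F s :=
  (integrable_cutKernel hα hϱ t).smul_bdd b hF.aestronglyMeasurable (ae_of_all _ hb)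

lemma intervalIntegrable_memoryKernel_smul (hα : 0 < α) (hϱ : 0 < ϱ) (hF : StronglyMeasurable F)
    (hb : ∀ s, ‖F s‖ ≤ b) {t : ℝ} (ht : 0 ≤ t) :
    IntervalIntegrable (fun s => memoryKernel α ϱ t s • F s) volume 0 t := by
  rw [intervalIntegrable_iff_integrableOn_Ioc_of_le ht, ← integrable_indicator_iff measurableSet_Ioc]
  exact (integrable_cutKernel_smul hα hϱ hF hb t).congr (ae_of_all _ fun s => cutKernel_smul F t s)

lemma integral_cutKernel_smul (F : ℝ → E) {t : ℝ} (ht : 0 ≤ t) :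
    ∫ s, cutKernel α ϱ t s • F s = ∫ s in (0 : ℝ)..t, memoryKernel α ϱ t s • F s := by
  simp only [cutKernel_smul]
  rw [integral_indicator measurableSet_Ioc, intervalIntegral.integral_of_le ht]

lemma norm_integral_cutKernel_smul_le (hα : 0 < α) (hϱ : 0 < ϱ) (hb0 : 0 ≤ b)
    (hb : ∀ s, ‖F s‖ ≤ b) {t : ℝ} (ht : 0 ≤ t) :
    ‖∫ s, cutKernel α ϱ t s • F s‖ ≤ ϱ ^ (-α) * b := by
  refine (norm_integral_le_of_norm_le ((integrable_cutKernel hα hϱ t).mul_const b)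
    (ae_of_all _ fun s => ?_)).trans ?_
  · rw [norm_smul, Real.norm_eq_abs, abs_of_nonneg (cutKernel_nonneg hα t s)]
    exact mul_le_mul_of_nonneg_left (hb s) (cutKernel_nonneg hα t s)
  · rw [integral_mul_const]
    exact mul_le_mul_of_nonneg_right (integral_cutKernel_le hα hϱ ht) hb0

/-- The increment is at most b times the L¹ distance of the two kernels, so `F` itself need not be
continuous. -/
lemma continuous_integral_cutKernel_smul (hα : 0 < α) (hϱ : 0 < ϱ) (hF : StronglyMeasurable F)
    (hb : ∀ s, ‖F s‖ ≤ b) : Continuous fun t => ∫ s, cutKernel α ϱ t s • F s := by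
  refine continuous_iff_continuousAt.2 fun t => tendsto_iff_norm_sub_tendsto_zero.2 ?_
  have h1 := tendsto_eLpNorm_cutKernel_sub (α := α) (ϱ := ϱ) ENNReal.one_ne_top
    (memLp_one_iff_integrable.2 (integrable_memoryDensity hα hϱ)) t
  have h2 : Tendsto (fun t' => ∫ s, ‖cutKernel α ϱ t' s - cutKernel α ϱ t s‖) (𝓝 t) (𝓝 0) := by
    have h3 := (ENNReal.tendsto_toReal ENNReal.zero_ne_top).comp h1
    rw [ENNReal.toReal_zero] at h3
    refine h3.congr fun t' => ?_
    have hint := (integrable_cutKernel (α := α) (ϱ := ϱ) hα hϱ t').sub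
      (integrable_cutKernel hα hϱ t)
    rw [Function.comp, eLpNorm_one_eq_lintegral_enorm,
      ← ofReal_integral_norm_eq_lintegral_enorm hint,
      ENNReal.toReal_ofReal (integral_nonneg fun _ => norm_nonneg _)]
    rfl
  have h4 := h2.mul_const b
  rw [zero_mul] at h4
  refine squeeze_zero (fun _ => norm_nonneg _) (fun t' => ?_) h4
  rw [← integral_sub (integrable_cutKernel_smul hα hϱ hF hb t')
    (integrable_cutKernel_smul hα hϱ hF hb t), ← integral_mul_const]
  refine norm_integral_le_of_norm_le (((integrable_cutKernel hα hϱ t').sub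
    (integrable_cutKernel hα hϱ t)).norm.mul_const b) (ae_of_all _ fun s => ?_)
  rw [← sub_smul, norm_smul]
  exact mul_le_mul_of_nonneg_left (hb s) (norm_nonneg _)

end VolterraIntegral

/-! ### Existence of solutions -/

section Existence

open scoped BoundedContinuousFunction

variable {Ω : Type*} [mΩ : MeasurableSpace Ω] {d : ℕ} {μ : Measure Ω} {P : Type*} [MetricSpace P]
  {L α ϱ H lam : ℝ} {g : EuclideanSpace ℝ (Fin d) → P → EuclideanSpace ℝ (Fin d)}
  {B : ℝ≥0 → Ω → EuclideanSpace ℝ (Fin d)}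

/-- The stochastic convolution of the memory kernel with the noise. -/
lemma IsTFBM.exists_stochasticConvolution (hB : IsTFBM μ H lam B) (hH : 1 / 2 < H)
    (hlam : 0 < lam) (hα : 1 / 2 < α) (hϱ : 0 < ϱ) {𝓕 : Filtration ℝ≥0 mΩ}
    (had : StronglyAdapted 𝓕 B) :
    ∃ Y : ℝ≥0 → L2 d μ, Continuous Y ∧ (∀ t, ‖Y t‖ ≤ noiseBound d H lam α ϱ) ∧
      (∀ t, AEStronglyMeasurable[𝓕 t] (Y t) μ) ∧
      ∀ t : ℝ≥0, IsWienerIntegral μ B t (memoryKernel α ϱ t) (Y t) := by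
  have hm : ∀ t : ℝ≥0, MemLp ((Ioc 0 (t : ℝ)).indicator (memoryKernel α ϱ t)) 2 volume :=
    fun t => memLp_two_cutKernel hα hϱ t
  choose Y hY using fun t : ℝ≥0 => hB.exists_isWienerIntegral hH hlam (hm t)
  refine ⟨Y, ?_, fun t => hB.norm_wienerIntegral_memoryKernel_le hH hlam hα hϱ (hY t),
    fun t => hB.aestronglyMeasurable_wienerIntegral had (hm t) (hY t), hY⟩
  refine continuous_iff_continuousAt.2 fun t => tendsto_iff_dist_tendsto_zero.2 ?_
  have h1 : Tendsto (fun t' : ℝ≥0 => dist ((hm t').toLp _) ((hm t).toLp _)) (𝓝 t) (𝓝 0) := by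
    have h2 := ((ENNReal.tendsto_toReal ENNReal.zero_ne_top).comp
      (tendsto_eLpNorm_cutKernel_sub (α := α) (ϱ := ϱ) ENNReal.ofNat_ne_top
        (memLp_two_memoryDensity hα hϱ) t)).comp (NNReal.continuous_coe.tendsto t)
    rw [ENNReal.toReal_zero] at h2
    refine h2.congr fun t' => ?_
    rw [dist_edist, Lp.edist_toLp_toLp]
    rfl
  have h3 := h1.const_mul (wienerConst d H lam)
  rw [mul_zero] at h3
  exact squeeze_zero (fun _ => dist_nonneg)
    (fun t' => hB.dist_wienerIntegral_le hH hlam (hm t') (hm t) (hY t') (hY t)) h3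

/-- The drift `s ↦ g(x(s), ϑ_s p)` along a curve `x`. -/
noncomputable def drift (g : EuclideanSpace ℝ (Fin d) → P → EuclideanSpace ℝ (Fin d))
    (ϑ : ℝ → P → P) (p : P) (x : ℝ≥0 → L2 d μ) (s : ℝ) : L2 d μ :=
  superposition g (ϑ s p) (x s.toNNReal)

lemma IsMeanLipschitz.stronglyMeasurable_drift [IsProbabilityMeasure μ]
    (hg : IsMeanLipschitz μ L g) (hL : 0 ≤ L) {ϑ : ℝ → P → P} {p : P}
    (hϑ : StronglyMeasurable fun t => ϑ t p) {x : ℝ≥0 → L2 d μ} (hx : Continuous x) :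
    StronglyMeasurable (drift g ϑ p x) :=
  (hg.continuous_superposition hL).comp_stronglyMeasurable
    (hϑ.prodMk (hx.comp continuous_real_toNNReal).stronglyMeasurable)

/-- Existence of solutions, by Picard iteration in the space of bounded continuous curves. -/
lemma IsMeanLipschitz.exists_isSolution [IsProbabilityMeasure μ] [CompactSpace P]
    (hg : IsMeanLipschitz μ L g) (hL : 0 ≤ L) (hB : IsTFBM μ H lam B) (hH : 1 / 2 < H)
    (hlam : 0 < lam) (hα : 1 / 2 < α) (hϱ : 0 < ϱ) (hsmall : √L * ϱ ^ (-α) ≤ 1 / 2)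
    {𝓕 : Filtration ℝ≥0 mΩ} (had : StronglyAdapted 𝓕 B) {ϑ : ℝ → P → P} {p : P}
    (hϑ : StronglyMeasurable fun t => ϑ t p) {x₀ : L2 d μ}
    (hx₀ : AEStronglyMeasurable[𝓕 0] x₀ μ) :
    ∃ x, IsSolution μ 𝓕 B α ϱ g ϑ x₀ p x := by
  have hα0 : 0 < α := by linarith
  obtain ⟨Y, hYc, hYb, hYm, hYW⟩ := hB.exists_stochasticConvolution hH hlam hα hϱ had
  obtain ⟨G, hG, hGle⟩ := hg.exists_norm_superposition_le (μ := μ) hL p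
  have hFm : ∀ x : ℝ≥0 →ᵇ L2 d μ, StronglyMeasurable (drift g ϑ p x) := fun x =>
    hg.stronglyMeasurable_drift hL hϑ x.continuous
  have hFb : ∀ (x : ℝ≥0 →ᵇ L2 d μ) s, ‖drift g ϑ p x s‖ ≤ G + √L * ‖x‖ := fun x s =>
    (hGle _ _).trans (by gcongr; exact x.norm_coe_le_norm _)
  let Φ₀ : (ℝ≥0 →ᵇ L2 d μ) → ℝ≥0 → L2 d μ := fun x t =>
    Real.exp (-ϱ * t) • x₀ + (∫ s, cutKernel α ϱ t s • drift g ϑ p x s) + Y t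
  have hΦc : ∀ x, Continuous (Φ₀ x) := fun x =>
    (((Real.continuous_exp.comp (by fun_prop : Continuous fun t : ℝ≥0 => -ϱ * (t : ℝ))).smul
      continuous_const).add ((continuous_integral_cutKernel_smul hα0 hϱ (hFm x) (hFb x)).comp
        NNReal.continuous_coe)).add hYc
  have hΦb : ∀ x t, ‖Φ₀ x t‖ ≤
      ‖x₀‖ + ϱ ^ (-α) * (G + √L * ‖x‖) + noiseBound d H lam α ϱ := fun x t => by
    refine norm_add₃_le.trans (add_le_add (add_le_add ?_ ?_) (hYb t))
    · rw [norm_smul, Real.norm_eq_abs, abs_of_pos (Real.exp_pos _)]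
      refine mul_le_of_le_one_left (norm_nonneg _) (Real.exp_le_one_iff.2 ?_)
      nlinarith [mul_nonneg hϱ.le t.coe_nonneg]
    · exact norm_integral_cutKernel_smul_le hα0 hϱ (by positivity) (hFb x) t.coe_nonneg
  let Φ : (ℝ≥0 →ᵇ L2 d μ) → (ℝ≥0 →ᵇ L2 d μ) := fun x =>
    BoundedContinuousFunction.ofNormedAddCommGroup (Φ₀ x) (hΦc x) _ (hΦb x)
  -- The Lipschitz factor √L ϱ^{-α} is uniform in time, so the map contracts in the supremum norm on
  -- all of [0,∞) and no continuation argument is needed.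
  have hcontr : ContractingWith (1 / 2) Φ := by
    refine ⟨by norm_num [← NNReal.coe_lt_coe], LipschitzWith.of_dist_le_mul fun x y => ?_⟩
    have hd : (0 : ℝ) ≤ dist x y := dist_nonneg
    refine (BoundedContinuousFunction.dist_le (by positivity)).2 fun t => ?_
    change dist (Φ₀ x t) (Φ₀ y t) ≤ _
    have hFsub : ∀ s, ‖drift g ϑ p x s - drift g ϑ p y s‖ ≤ √L * dist x y := fun s => by
      refine (hg.norm_superposition_sub_le hL _ _ _ _).trans ?_
      rw [dist_self, add_zero, ← dist_eq_norm]
      gcongr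
      exact BoundedContinuousFunction.dist_coe_le_dist _
    have hsub : Φ₀ x t - Φ₀ y t =
        ∫ s, cutKernel α ϱ t s • (drift g ϑ p x s - drift g ϑ p y s) := by
      simp only [smul_sub]
      rw [integral_sub (integrable_cutKernel_smul hα0 hϱ (hFm x) (hFb x) t)
        (integrable_cutKernel_smul hα0 hϱ (hFm y) (hFb y) t)]
      simp only [Φ₀]
      abel
    rw [dist_eq_norm, hsub]
    refine (norm_integral_cutKernel_smul_le hα0 hϱ (by positivity) hFsub t.coe_nonneg).trans ?_
    rw [← mul_assoc, mul_comm (ϱ ^ (-α))]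
    exact (mul_le_mul_of_nonneg_right hsmall hd).trans_eq (by norm_num)
  -- Adaptedness of the fixed point is obtained from the iterates: the zero curve is adapted, the
  -- Picard map preserves adaptedness since only times s ≤ t enter, and the property passes to the
  -- limit.
  have hadapt : ∀ x : ℝ≥0 →ᵇ L2 d μ, (∀ t, AEStronglyMeasurable[𝓕 t] (x t) μ) →
      ∀ t, AEStronglyMeasurable[𝓕 t] (Φ x t) μ := by
    intro x hx t
    let S : Submodule ℝ (L2 d μ) := lpMeas (EuclideanSpace ℝ (Fin d)) ℝ (𝓕 t) 2 μ
    have hS : ∀ {z : L2 d μ}, z ∈ S ↔ AEStronglyMeasurable[𝓕 t] z μ :=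
      mem_lpMeas_iff_aestronglyMeasurable
    have hScl : IsClosed (S : Set (L2 d μ)) := by
      have : (S : Set (L2 d μ)) = {z : L2 d μ | AEStronglyMeasurable[𝓕 t] z μ} := by
        ext z; exact hS
      rw [this]
      exact isClosed_aestronglyMeasurable (𝓕.le t)
    refine hS.1 (S.add_mem (S.add_mem (S.smul_mem _ ?_) ?_) (hS.2 (hYm t)))
    · exact hS.2 (hx₀.mono (𝓕.mono zero_le))
    · refine S.integral_mem_of_forall_mem hScl
        (integrable_cutKernel_smul hα0 hϱ (hFm x) (hFb x) t) fun s => ?_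
      by_cases hs : s ∈ Ioc 0 (t : ℝ)
      · refine S.smul_mem _ (hS.2 (hg.aestronglyMeasurable_superposition hL _ ?_))
        refine (hx s.toNNReal).mono (𝓕.mono ?_)
        rw [← NNReal.coe_le_coe, Real.coe_toNNReal s hs.1.le]
        exact hs.2
      · rw [cutKernel, indicator_of_notMem hs, zero_smul]
        exact S.zero_mem
  have hiter : ∀ n t, AEStronglyMeasurable[𝓕 t] (Φ^[n] 0 t) μ := by
    intro n
    induction n with
    | zero =>
      intro t
      exact (stronglyMeasurable_zero.aestronglyMeasurable).congr
        (Lp.coeFn_zero (EuclideanSpace ℝ (Fin d)) 2 μ).symm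
    | succ n ih =>
      rw [Function.iterate_succ_apply']
      exact hadapt _ ih
  let xf : ℝ≥0 →ᵇ L2 d μ := hcontr.fixedPoint Φ
  have hfix : Φ xf = xf := hcontr.fixedPoint_isFixedPt
  have hlim := hcontr.tendsto_iterate_fixedPoint (0 : ℝ≥0 →ᵇ L2 d μ)
  refine ⟨xf, xf.continuous, fun t => ?_, fun t => ?_,
    fun t => ⟨Y t, hYW t, ?_⟩⟩
  · exact (isClosed_aestronglyMeasurable (F := EuclideanSpace ℝ (Fin d)) (p := 2) (μ := μ)
      (𝓕.le t)).mem_of_tendsto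
      (((BoundedContinuousFunction.lipschitz_eval_const t).continuous.tendsto xf).comp hlim)
      (Eventually.of_forall fun n => hiter n t)
  · exact intervalIntegrable_memoryKernel_smul hα0 hϱ (hFm _) (hFb _) t.coe_nonneg
  · have h := congrFun (congrArg DFunLike.coe hfix) t
    refine h.symm.trans ?_
    change Real.exp (-ϱ * t) • x₀ + (∫ s, cutKernel α ϱ t s • drift g ϑ p _ s) + Y t = _
    rw [integral_cutKernel_smul _ t.coe_nonneg]
    rfl

end Existence

/-! ### The main theorem -/

theorem theorem3 (α L : ℝ) (hα : 1 / 2 < α) (hL : 0 < L) :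
    ∃ ϱ₀ : ℝ, 0 < ϱ₀ ∧ ∀ ϱ : ℝ, ϱ₀ ≤ ϱ →
    -- the filtered probability space and the tempered fractional Brownian motion
    ∀ (Ω : Type*) [mΩ : MeasurableSpace Ω] (μ : Measure Ω) [IsProbabilityMeasure μ]
      (𝓕 : Filtration ℝ≥0 mΩ) (d : ℕ) (H lam : ℝ), 1 / 2 < H → 0 < lam →
    ∀ B : ℝ≥0 → Ω → EuclideanSpace ℝ (Fin d), IsTFBM μ H lam B → StronglyAdapted 𝓕 B →
    -- the driving system on the compact metric space `P`, with base point `o`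
    ∀ (P : Type*) [MetricSpace P] [CompactSpace P] (o : P) (ϑ : ℝ → P → P),
      (∀ p, ϑ 0 p = p) → (∀ s t p, ϑ (s + t) p = ϑ s (ϑ t p)) → (∀ t, Continuous (ϑ t)) →
      (∀ p, StronglyMeasurable fun t => ϑ t p) →
    ∀ M : ℝ, 0 < M →
      (∀ t : ℝ, 0 < t → ∀ p,
        ∫ s in (0 : ℝ)..t, memoryKernel α ϱ t s * dist (ϑ s p) o ^ 2 < M) →
    -- the vector field
    ∀ g : EuclideanSpace ℝ (Fin d) → P → EuclideanSpace ℝ (Fin d),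
      (∀ (x y : L2 d μ) (p q : P),
        ∫⁻ ω, ‖g (x ω) p - g (y ω) q‖ₑ ^ 2 ∂μ ≤
          ENNReal.ofReal L * ∫⁻ ω, ‖x ω - y ω‖ₑ ^ 2 ∂μ + ENNReal.ofReal (L * dist p q ^ 2)) →
    -- (i)
    (∀ D : Set (L2 d μ), IsBoundedInitialSet 𝓕 D →
      ∀ (t : ℕ → ℝ≥0) (x₀ : ℕ → L2 d μ) (p : ℕ → P) (x : ℕ → ℝ≥0 → L2 d μ),
        Tendsto t atTop atTop → (∀ n, x₀ n ∈ D) →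
        (∀ n, IsSolution μ 𝓕 B α ϱ g ϑ (x₀ n) (p n) (x n)) →
        IsCompact (closure (range fun n => toL2w (x n (t n)))) ∧
        ∃ (y : L2w d μ) (φ : ℕ → ℕ), StrictMono φ ∧
          Tendsto (fun k => toL2w (x (φ k) (t (φ k)))) atTop (𝓝 y)) ∧
    -- (ii)
    (∀ D : Set (L2 d μ), IsBoundedInitialSet 𝓕 D →
      (D.Nonempty → (weakOmegaLimit (IsSolution μ 𝓕 B α ϱ g ϑ) D).Nonempty) ∧
      IsCompact (weakOmegaLimit (IsSolution μ 𝓕 B α ϱ g ϑ) D) ∧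
      WeaklyAttracts (IsSolution μ 𝓕 B α ϱ g ϑ)
        (weakOmegaLimit (IsSolution μ 𝓕 B α ϱ g ϑ) D) D) ∧
    -- (iii)
    (Bornology.IsBounded (toL2w ⁻¹' weakOmegaStar 𝓕 (IsSolution μ 𝓕 B α ϱ g ϑ)) ∧
      IsCompact (weakOmegaStar 𝓕 (IsSolution μ 𝓕 B α ϱ g ϑ)) ∧
      IsLeast {A : Set (L2w d μ) | IsClosed A ∧
        ∀ D : Set (L2 d μ), IsBoundedInitialSet 𝓕 D →
          WeaklyAttracts (IsSolution μ 𝓕 B α ϱ g ϑ) A D}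
        (weakOmegaStar 𝓕 (IsSolution μ 𝓕 B α ϱ g ϑ))) := by
  -- The threshold is the solution of (ϱ/2)^α = 2√L, that is, of √L(ϱ/2)^{-α} = 1/2.
  refine ⟨2 * (2 * √L) ^ (1 / α), by positivity, fun ϱ hϱ₀ => ?_⟩
  intro Ω mΩ μ _ 𝓕 d H lam hH hlam B hB had P _ _ o ϑ _ _ _ hϑ M _ _ g hg
  have hα0 : 0 < α := by linarith
  have hroot : 0 < 2 * √L := by positivity
  have hϱ : 0 < ϱ := lt_of_lt_of_le (by positivity) hϱ₀
  have hsmall : √L * (ϱ / 2) ^ (-α) ≤ 1 / 2 := by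
    have h1 : 2 * √L ≤ (ϱ / 2) ^ α := by
      calc 2 * √L = ((2 * √L) ^ (1 / α)) ^ α := by
            rw [← Real.rpow_mul hroot.le, one_div_mul_cancel hα0.ne', Real.rpow_one]
        _ ≤ (ϱ / 2) ^ α := Real.rpow_le_rpow (by positivity) (by linarith) hα0.le
    rw [Real.rpow_neg (by positivity), ← div_eq_mul_inv, div_le_iff₀ (by positivity)]
    linarith
  have hsmall' : √L * ϱ ^ (-α) ≤ 1 / 2 :=
    (mul_le_mul_of_nonneg_left (Real.rpow_le_rpow_of_nonpos (by linarith) (by linarith)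
      (by linarith)) (Real.sqrt_nonneg _)).trans hsmall
  have hg' : IsMeanLipschitz μ L g := hg
  obtain ⟨K, hK⟩ := hg'.exists_isDissipative hL.le o hB hH hlam hα hϱ hsmall 𝓕 ϑ
  have hη : 0 < ϱ / 2 := half_pos hϱ
  refine ⟨fun D hD t x₀ p x _ hx₀ hx => ⟨?_, ?_⟩, fun D hD => ⟨?_, ?_, ?_⟩, ?_, ?_, ?_⟩
  · exact hK.isCompact_closure_range hη hD.2 hx₀ hx
  · exact hK.exists_subseq_tendsto hη hD.2 hx₀ hx
  · rintro ⟨x₀, hx₀⟩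
    -- One parameter suffices for nonemptiness; the base point is at hand.
    obtain ⟨x, hx⟩ := hg'.exists_isSolution hL.le hB hH hlam hα hϱ hsmall' had (hϑ o)
      (hD.1 x₀ hx₀)
    exact hK.weakOmegaLimit_nonempty hη hD.2 hx₀ hx
  · exact hK.isCompact_weakOmegaLimit hη hD.2
  · exact hK.weaklyAttracts_weakOmegaLimit hη hD.2
  · exact hK.isBounded_weakOmegaStar hη
  · exact hK.isCompact_weakOmegaStar hη
  · exact hK.isLeast_weakOmegaStar hη
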